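/- Let $M$ be a smooth manifold of dimension $n$, $g$ a semi-Riemannian metric on $M$ and $\theta\in C^\infty(M)$. Let $\hat TM=TM\oplus\mathbb R$ be the graded tangent bundle, whose sections are written $X+f\xi$ with $X$ a smooth vector field, $f\in C^\infty(M)$ and $\xi=(0,1)$ the constant odd section. It is a Lie algebroid with anchor $\rho(X+f\xi)=X$ and bracket $$[X+f\xi,\;Y+k\xi]=[X,Y]+\big(X(k)-Y(f)\big)\xi .$$ Let $\hat g=(g,\theta)$ be the graded metric on $\hat TM$ given by $$\langle X+f\xi,\;Y+k\xi\rangle=g(X,Y)+e^{2\theta}fk .$$ For a metric $\langle\cdot,\cdot\rangle$ on $TM$ or $\hat TM$, with $X(f)$ meaning $\rho(X)(f)$, let $\nabla$ be its Levi-Civita connection, determined by the Koszul formula $$2\langle\nabla_XY,Z\rangle=X\langle Y,Z\rangle+Y\langle Z,X\rangle-Z\langle X,Y\rangle+\langle[X,Y],Z\rangle-\langle[Y,Z],X\rangle+\langle[Z,X],Y\rangle ,$$ let $R(X,Y)Z=\nabla_X\nabla_YZ-\nabla_Y\nabla_XZ-\nabla_{[X,Y]}Z$ be its curvature tensor, and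 let $$\mathrm{Ric}(X,Y)=\sum_i\varepsilon_i\,\langle R(X,E_i)E_i,\,Y\rangle$$ be its Ricci tensor, where $(E_i)$ is any local orthonormal frame of the bundle and $\varepsilon_i=\langle E_i,E_i\rangle=\pm1$. Write $\mathrm{Ric}$ for the Ricci tensor of $g$ and $\widehat{\mathrm{Ric}}$ for the Ricci tensor of $\hat g$. Set $$\tilde T=\mathrm{Hess}(\theta)+d\theta\otimes d\theta,\qquad \mathrm{Hess}(\theta)(X,Y)=(\nabla_Xd\theta)(Y)=X(Y\theta)-(\nabla_XY)\theta ,$$ with $\nabla$ the Levi-Civita connection of $g$, and let $\mathrm{tr}\,\tilde T=g^{ij}\tilde T_{ij}$ be its trace with respect to $g$. Then at every point of $M$ and for all tangent vectors $X,Y$ of $M$ there: $$\widehat{\mathrm{Ric}}(X,Y)=\mathrm{Ric}(X,Y)-\tilde T(X,Y),\qquad \widehat{\mathrm{Ric}}(X,\xi)=0,\qquad \widehat{\mathrm{Ric}}(\xi,\xi)=-e^{2\theta}\,\mathrm{tr}\,\tilde T .$$ -/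

import Mathlib

open Bundle Module
open scoped Manifold ContDiff

noncomputable section

namespace GradedGeometry

section General

variable {E : Type*} [NormedAddCommGroup E] [NormedSpace ℝ E]
  {H : Type*} [TopologicalSpace H] (I : ModelWithCorners ℝ E H)
  {M : Type*} [TopologicalSpace M] [ChartedSpace H M]
  (F : Type*) [NormedAddCommGroup F] [NormedSpace ℝ F]
  (A : M → Type*) [TopologicalSpace (TotalSpace F A)]
  [∀ x, AddCommGroup (A x)] [∀ x, Module ℝ (A x)] [∀ x, TopologicalSpace (A x)]
  [FiberBundle F A]

/-- The section `s` of the bundle `A` is smooth at the point `p`. -/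
def SmoothSectionAt (s : Π x, A x) (p : M) : Prop :=
  ContMDiffAt I (I.prod 𝓘(ℝ, F)) ∞ (fun x ↦ TotalSpace.mk' F x (s x)) p

/-- A semi-Riemannian metric on a vector bundle `A`: a symmetric nondegenerate bilinear form on each
fibre, depending smoothly on the point (the product of smooth sections is smooth). -/
structure SemiRiemannianMetric where
  /-- the scalar product on each fibre -/
  val : ∀ x, LinearMap.BilinForm ℝ (A x)
  symm : ∀ x v w, val x v w = val x w v
  nondegenerate : ∀ x, (val x).Nondegenerate
  smooth : ∀ (p : M) (s t : Π x, A x), SmoothSectionAt I F A s p → SmoothSectionAt I F A t p →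
    ContMDiffAt I 𝓘(ℝ, ℝ) ∞ (fun x ↦ val x (s x) (t x)) p

/-- The two operations of a Lie algebroid `A → M`: the anchor `A → TM` and the bracket of sections.
They are used below only for the tangent bundle and for the graded tangent bundle. -/
structure AlgebroidOps where
  /-- the anchor map `ρ` -/
  anchor : ∀ x, A x →ₗ[ℝ] TangentSpace I x
  /-- the bracket of sections -/
  bracket : (Π x, A x) → (Π x, A x) → (Π x, A x)

end General

section Curvature

variable {E : Type*} [NormedAddCommGroup E] [NormedSpace ℝ E]
  {H : Type*} [TopologicalSpace H] {I : ModelWithCorners ℝ E H}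
  {M : Type*} [TopologicalSpace M] [ChartedSpace H M]
  {F : Type*} [NormedAddCommGroup F] [NormedSpace ℝ F]
  {A : M → Type*} [TopologicalSpace (TotalSpace F A)]
  [∀ x, AddCommGroup (A x)] [∀ x, Module ℝ (A x)] [∀ x, TopologicalSpace (A x)]
  [FiberBundle F A]

/-- The derivative `X(f) = ρ(X)(f)` at `p` of a function along a section of the algebroid. -/
def AlgebroidOps.der (𝔞 : AlgebroidOps I A) (X : Π x, A x) (f : M → ℝ) (p : M) : ℝ :=
  mvfderiv I f p (𝔞.anchor p (X p))

/-- The right-hand side of the Koszul formula: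
`X⟨Y,Z⟩ + Y⟨Z,X⟩ - Z⟨X,Y⟩ + ⟨[X,Y],Z⟩ - ⟨[Y,Z],X⟩ + ⟨[Z,X],Y⟩`. -/
def koszul (𝔞 : AlgebroidOps I A) (g : SemiRiemannianMetric I F A) (X Y Z : Π x, A x) (p : M) : ℝ :=
  𝔞.der X (fun x ↦ g.val x (Y x) (Z x)) p
    + 𝔞.der Y (fun x ↦ g.val x (Z x) (X x)) p
    - 𝔞.der Z (fun x ↦ g.val x (X x) (Y x)) p
    + g.val p (𝔞.bracket X Y p) (Z p)
    - g.val p (𝔞.bracket Y Z p) (X p)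
    + g.val p (𝔞.bracket Z X p) (Y p)

open Classical in
/-- The Levi-Civita connection: `∇_X Y` at `p` is the vector `v` such that the Koszul formula
`2⟨v, Z⟩ = koszul X Y Z` holds at `p` for all smooth `Z`. (There is exactly one such vector
if `X` and `Y` are smooth at `p`; the value `0` is used otherwise.) -/
def leviCivita (𝔞 : AlgebroidOps I A) (g : SemiRiemannianMetric I F A) (X Y : Π x, A x) :
    Π x, A x := fun p ↦
  if h : ∃ v : A p, ∀ Z : Π x, A x, SmoothSectionAt I F A Z p →
      2 * g.val p v (Z p) = koszul 𝔞 g X Y Z p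
  then h.choose else 0

/-- The curvature `R(X,Y)Z = ∇_X ∇_Y Z - ∇_Y ∇_X Z - ∇_[X,Y] Z` on sections. -/
def curvature (𝔞 : AlgebroidOps I A) (g : SemiRiemannianMetric I F A) (X Y Z : Π x, A x) :
    Π x, A x := fun p ↦
  leviCivita 𝔞 g X (leviCivita 𝔞 g Y Z) p - leviCivita 𝔞 g Y (leviCivita 𝔞 g X Z) p
    - leviCivita 𝔞 g (𝔞.bracket X Y) Z p

open Classical in
/-- The curvature tensor at `p`: the trilinear map on the fibre with
`R_p (X p) (Y p) (Z p) = (R(X,Y)Z) p` for all sections `X`, `Y`, `Z` smooth at `p`. -/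
def curvatureTensor (𝔞 : AlgebroidOps I A) (g : SemiRiemannianMetric I F A) (p : M) :
    A p →ₗ[ℝ] A p →ₗ[ℝ] A p →ₗ[ℝ] A p :=
  if h : ∃ R : A p →ₗ[ℝ] A p →ₗ[ℝ] A p →ₗ[ℝ] A p, ∀ X Y Z : Π x, A x,
      SmoothSectionAt I F A X p → SmoothSectionAt I F A Y p → SmoothSectionAt I F A Z p →
      R (X p) (Y p) (Z p) = curvature 𝔞 g X Y Z p
  then h.choose else 0

/-- The Hessian `Hess(f)(X,Y) = (∇_X df)(Y) = X(Y f) - (∇_X Y) f` on sections. -/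
def hessianField (𝔞 : AlgebroidOps I A) (g : SemiRiemannianMetric I F A) (f : M → ℝ)
    (X Y : Π x, A x) (p : M) : ℝ :=
  𝔞.der X (𝔞.der Y f) p - 𝔞.der (leviCivita 𝔞 g X Y) f p

open Classical in
/-- The Hessian tensor of `f` at `p`: the bilinear form on the fibre with
`Hess(f)_p (X p) (Y p) = (Hess(f)(X,Y)) p` for all sections `X`, `Y` smooth at `p`. -/
def hessian (𝔞 : AlgebroidOps I A) (g : SemiRiemannianMetric I F A) (f : M → ℝ) (p : M) :
    LinearMap.BilinForm ℝ (A p) :=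
  if h : ∃ B : LinearMap.BilinForm ℝ (A p), ∀ X Y : Π x, A x,
      SmoothSectionAt I F A X p → SmoothSectionAt I F A Y p →
      B (X p) (Y p) = hessianField 𝔞 g f X Y p
  then h.choose else 0

variable [FiniteDimensional ℝ F] [VectorBundle ℝ F A]

/-- The metric trace `tr B = g^{ij} B_{ij}` of a bilinear form `B` on the fibre at `p`: the trace of
the endomorphism `L` with `⟨L v, w⟩ = B(v, w)`. For an orthonormal basis `E_i` with
`ε_i = ⟨E_i,E_i⟩ = ± 1` this is `∑ ε_i B(E_i,E_i)`. -/
def SemiRiemannianMetric.trace (g : SemiRiemannianMetric I F A) (p : M)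
    (B : LinearMap.BilinForm ℝ (A p)) : ℝ :=
  haveI : FiniteDimensional ℝ (A p) := VectorBundle.finiteDimensional ℝ F A p
  LinearMap.trace ℝ (A p) (B.symmCompOfNondegenerate (g.val p) (g.nondegenerate p))

/-- The Ricci tensor at `p`: `Ric(v,w)` is the metric trace of `(a,b) ↦ ⟨R(v,a)b, w⟩`, that is
`∑ ε_i ⟨R(v,E_i)E_i, w⟩` for an orthonormal basis `E_i`. -/
def ricci (𝔞 : AlgebroidOps I A) (g : SemiRiemannianMetric I F A) (p : M) (v w : A p) : ℝ :=
  g.trace p ((curvatureTensor 𝔞 g p v).compr₂ ((g.val p).flip w))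

end Curvature

section Tangent

variable {E : Type*} [NormedAddCommGroup E] [NormedSpace ℝ E]
  {H : Type*} [TopologicalSpace H] (I : ModelWithCorners ℝ E H)
  (M : Type*) [TopologicalSpace M] [ChartedSpace H M]

/-- The tangent bundle as a Lie algebroid: identity anchor, Lie bracket of vector fields. -/
def tangentOps : AlgebroidOps I (TangentSpace I : M → Type _) where
  anchor _ := LinearMap.id
  bracket X Y := VectorField.mlieBracket I X Y

/-- The graded tangent bundle `T̂M = TM ⊕ ℝ`; its fibre at `p` is `T_pM × ℝ` and the pair
`(v, t)` stands for `v + t ξ`. -/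
abbrev GradedTangent : M → Type _ := (TangentSpace I : M → Type _) ×ᵇ Bundle.Trivial M ℝ

/-- The graded tangent bundle as a Lie algebroid: the anchor is `ρ(X + f ξ) = X`, and the bracket is
`[X + f ξ, Y + k ξ] = [X,Y] + (X(k) - Y(f)) ξ`. -/
def gradedOps : AlgebroidOps I (GradedTangent I M) where
  anchor x := LinearMap.fst ℝ (TangentSpace I x) ℝ
  bracket X Y := fun p ↦
    (VectorField.mlieBracket I (fun x ↦ (X x).1) (fun x ↦ (Y x).1) p,
      (mvfderiv I (fun x ↦ ((Y x).2 : ℝ)) p (X p).1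
        - mvfderiv I (fun x ↦ ((X x).2 : ℝ)) p (Y p).1 : ℝ))

variable {I M}

/-- The even vector `v + 0 ξ` of the graded tangent space at `p`. -/
def even {p : M} (v : TangentSpace I p) : GradedTangent I M p := (v, (0 : ℝ))

variable (I) in
/-- The odd vector `ξ` at `p`. -/
def xi (p : M) : GradedTangent I M p := ((0 : TangentSpace I p), (1 : ℝ))

end Tangent

section Metric

variable {E : Type*} [NormedAddCommGroup E] [NormedSpace ℝ E]
  {H : Type*} [TopologicalSpace H] {I : ModelWithCorners ℝ E H}
  {M : Type*} [TopologicalSpace M] [ChartedSpace H M] [IsManifold I ∞ M]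

/-- A smooth section of `T̂M` is a pair of a smooth vector field and a smooth function. -/
theorem smoothSectionAt_graded_iff (s : Π x, GradedTangent I M x) (p : M) :
    SmoothSectionAt I (E × ℝ) (GradedTangent I M) s p ↔
      SmoothSectionAt I E (TangentSpace I : M → Type _) (fun x ↦ (s x).1) p ∧
        ContMDiffAt I 𝓘(ℝ, ℝ) ∞ (fun x ↦ ((s x).2 : ℝ)) p := by
  unfold SmoothSectionAt
  rw [contMDiffAt_section, contMDiffAt_section]
  exact contMDiffAt_prod_module_iff _

/-- The graded metric `ĝ = (g,θ)`: `⟨X + f ξ, Y + k ξ⟩ = g(X,Y) + e^{2θ} f k`. -/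
def gradedMetric (g : SemiRiemannianMetric I E (TangentSpace I : M → Type _))
    (θ : C^∞⟮I, M; ℝ⟯) : SemiRiemannianMetric I (E × ℝ) (GradedTangent I M) where
  val x := LinearMap.mk₂ ℝ
    (fun a b : TangentSpace I x × ℝ ↦ g.val x a.1 b.1 + Real.exp (2 * θ x) * (a.2 * b.2))
    (fun a a' b ↦ by simp; ring) (fun c a b ↦ by simp; ring)
    (fun a b b' ↦ by simp; ring) (fun c a b ↦ by simp; ring)
  symm x v w := by
    change g.val x v.1 w.1 + _ * (v.2 * w.2 : ℝ) = g.val x w.1 v.1 + _ * (w.2 * v.2 : ℝ)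
    rw [g.symm x v.1 w.1, mul_comm (v.2 : ℝ)]
  nondegenerate x := by
    have hs : ∀ v : TangentSpace I x × ℝ, (∀ w : TangentSpace I x × ℝ,
        g.val x v.1 w.1 + Real.exp (2 * θ x) * (v.2 * w.2) = 0) → v = 0 := by
      intro v hv
      have h1 : v.1 = 0 := (g.nondegenerate x).1 v.1 fun w ↦ by simpa using hv (w, 0)
      have h2 : v.2 = 0 := by simpa [Real.exp_ne_zero] using hv (0, 1)
      exact Prod.ext h1 h2
    refine ⟨fun v hv ↦ hs v hv, fun v hv ↦ hs v fun w ↦ ?_⟩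
    rw [g.symm x v.1 w.1, mul_comm v.2]
    exact hv w
  smooth p s t hs ht := by
    rw [smoothSectionAt_graded_iff] at hs ht
    have hθ : ContMDiffAt I 𝓘(ℝ, ℝ) ∞ (fun x ↦ Real.exp (2 * θ x)) p :=
      Real.contDiff_exp.contMDiff.contMDiffAt.comp p
        (contMDiffAt_const.mul θ.contMDiff.contMDiffAt)
    exact (g.smooth p _ _ hs.1 ht.1).add (hθ.mul (hs.2.mul ht.2))

end Metric

section Graded

variable {E : Type*} [NormedAddCommGroup E] [NormedSpace ℝ E]
  {H : Type*} [TopologicalSpace H] {I : ModelWithCorners ℝ E H}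
  {M : Type*} [TopologicalSpace M] [ChartedSpace H M] [IsManifold I ∞ M]

/-- The tensor `T̃ = Hess(θ) + dθ ⊗ dθ` at `p`, for the Levi-Civita connection of `g`. -/
def tensorT (g : SemiRiemannianMetric I E (TangentSpace I : M → Type _)) (θ : M → ℝ) (p : M) :
    LinearMap.BilinForm ℝ (TangentSpace I p) :=
  hessian (tangentOps I M) g θ p
    + LinearMap.BilinForm.linMulLin (mvfderiv I θ p).toLinearMap (mvfderiv I θ p).toLinearMap

end Graded

end GradedGeometry

end

/-!
The Levi-Civita connection of the graded metric is computed explicitly in terms of the Levi-Civita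
connection `∇` of `g` (`leviCivita_graded`):
`∇̂_{X + f ξ}(Y + k ξ) = ∇_X Y - e^{2θ} f k grad θ + (X(k) + X(θ) k + f Y(θ)) ξ`.
The right-hand side satisfies the Koszul formula, and nondegeneracy makes this solution unique.
Differentiating once more (`leviCivita_leviCivita_graded`), all derivatives of the odd coefficients
cancel in the curvature, which leaves the tensor (`curvatureTensor_graded`)
`R̂(v + a ξ, y + b ξ)(z + c ξ)`
`  = R(v, y) z - e^{2θ} c (b T̃♯ v - a T̃♯ y) + (b T̃(v, z) - a T̃(y, z)) ξ`,
where `T̃♯ X = ∇_X grad θ + X(θ) grad θ` is metrically dual to `T̃`. The three Ricci formulas follow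
because the graded trace of a bilinear form is its trace over even vectors plus `e^{-2θ}` times its
value at `(ξ, ξ)` (`trace_gradedMetric`).

The tangent side needs the fundamental theorem of semi-Riemannian geometry. The Koszul expression is
linear over functions in its last argument, so that it is represented by a vector
(`two_mul_val_cov`); this holds at every point where the fields are differentiable. Since smoothness
at `p` gives differentiability near `p`, but not smoothness near `p`, it is this generality that
allows covariant derivatives to be iterated. Smoothness of `∇_X Y` follows by solving for its frame
coordinates with Cramer's rule (`SemiRiemannianMetric.smoothSectionAt_of_pairing`). Tensoriality of
the curvature in its last slot requires `[X, Y] f = X(Y f) - Y(X f)`, which is extracted from the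
Jacobi identity for `X`, `Y` and `f Z` (`mvfderiv_mlieBracket`).
-/

noncomputable section

namespace GradedGeometry

/-! ### Smooth functions and smooth sections -/

section Functions

variable {E : Type*} [NormedAddCommGroup E] [NormedSpace ℝ E]
  {H : Type*} [TopologicalSpace H] {I : ModelWithCorners ℝ E H}
  {M : Type*} [TopologicalSpace M] [ChartedSpace H M]

theorem mdifferentiableAt_fun_sum {ι : Type*} [Fintype ι] {f : ι → M → ℝ} {p : M}
    (hf : ∀ i, MDifferentiableAt I 𝓘(ℝ, ℝ) (f i) p) :
    MDifferentiableAt I 𝓘(ℝ, ℝ) (fun x ↦ ∑ i, f i x) p := by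
  classical
  have h (J : Finset ι) : MDifferentiableAt I 𝓘(ℝ, ℝ) (fun x ↦ ∑ i ∈ J, f i x) p := by
    induction J using Finset.induction_on with
    | empty => simpa using mdifferentiableAt_const
    | insert i J hi ih =>
      simp only [Finset.sum_insert hi]
      exact (hf i).add ih
  exact h Finset.univ

theorem contMDiffAt_det {ι : Type*} [Fintype ι] [DecidableEq ι] {G : M → Matrix ι ι ℝ} {p : M}
    (hG : ∀ i j, ContMDiffAt I 𝓘(ℝ, ℝ) ∞ (fun x ↦ G x i j) p) :
    ContMDiffAt I 𝓘(ℝ, ℝ) ∞ (fun x ↦ (G x).det) p := by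
  simp only [Matrix.det_apply']
  exact ContMDiffAt.sum fun σ _ ↦ contMDiffAt_const.mul (ContMDiffAt.prod fun i _ ↦ hG _ _)

/-- The solution `c` of a linear system `G c = a` with smooth coefficients and nonzero determinant
is smooth, by Cramer's rule. -/
theorem contMDiffAt_of_mulVec {ι : Type*} [Fintype ι] [DecidableEq ι] {G : M → Matrix ι ι ℝ}
    {c : M → ι → ℝ} {p : M} (hG : ∀ i j, ContMDiffAt I 𝓘(ℝ, ℝ) ∞ (fun x ↦ G x i j) p)
    (hdet : (G p).det ≠ 0)
    (ha : ∀ i, ContMDiffAt I 𝓘(ℝ, ℝ) ∞ (fun x ↦ (G x).mulVec (c x) i) p) (i : ι) :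
    ContMDiffAt I 𝓘(ℝ, ℝ) ∞ (fun x ↦ c x i) p := by
  have hd := contMDiffAt_det hG
  have hnum : ContMDiffAt I 𝓘(ℝ, ℝ) ∞
      (fun x ↦ ((G x).updateCol i ((G x).mulVec (c x))).det) p := by
    refine contMDiffAt_det fun j k ↦ ?_
    by_cases hk : k = i
    · subst hk
      simpa using ha j
    · simpa [Matrix.updateCol_ne hk] using hG j k
  refine (hnum.mul (hd.inv₀ hdet)).congr_of_eventuallyEq ?_
  filter_upwards [hd.continuousAt.eventually_ne hdet] with x hx
  have h : ((G x).updateCol i ((G x).mulVec (c x))).det = (G x).det * c x i := by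
    rw [← Matrix.cramer_apply, Matrix.cramer_eq_adjugate_mulVec, Matrix.mulVec_mulVec,
      Matrix.adjugate_mul, Matrix.smul_mulVec, Matrix.one_mulVec]
    rfl
  rw [Pi.mul_apply, h]
  field_simp

/-- Smoothness at a point implies differentiability on a neighbourhood, although the neighbourhood
on which the map is `C^k` may shrink as `k` grows. -/
theorem eventually_mdifferentiableAt {N EN HN : Type*} [NormedAddCommGroup EN] [NormedSpace ℝ EN]
    [TopologicalSpace HN] {IN : ModelWithCorners ℝ EN HN} [TopologicalSpace N] [ChartedSpace HN N]
    [IsManifold I 1 M] [IsManifold IN 1 N] {f : M → N} {p : M} (hf : ContMDiffAt I IN ∞ f p) :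
    ∀ᶠ x in nhds p, MDifferentiableAt I IN f x := by
  have h1 : ContMDiffAt I IN 1 f p := hf.of_le (by simp)
  filter_upwards [(contMDiffAt_iff_contMDiffAt_nhds (by simp)).1 h1] with x hx
  exact hx.mdifferentiableAt (by simp)

theorem mvfderiv_congr {f h : M → ℝ} {p : M} (hf : f =ᶠ[nhds p] h) :
    mvfderiv I f p = mvfderiv I h p := by
  ext v
  simp only [mvfderiv, hf.mfderiv_eq]
  rfl

theorem mdifferentiableAt_exp_two_mul {θ : M → ℝ} {p : M} (hθ : MDiffAt θ p) :
    MDiffAt (fun x ↦ Real.exp (2 * θ x)) p := by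
  have hc : MDiffAt (fun _ : M ↦ (2 : ℝ)) p := mdifferentiableAt_const
  have h1 : MDiffAt (fun x ↦ 2 * θ x) p := hc.mul hθ
  have h2 : MDiffAt Real.exp (2 * θ p) := Real.differentiableAt_exp.mdifferentiableAt
  exact MDifferentiableAt.comp (g := Real.exp) p h2 h1

theorem mvfderiv_exp_two_mul {θ : M → ℝ} {p : M} (hθ : MDiffAt θ p) (v : TangentSpace I p) :
    mvfderiv I (fun x ↦ Real.exp (2 * θ x)) p v =
      2 * Real.exp (2 * θ p) * mvfderiv I θ p v := by
  have hc : MDiffAt (fun _ : M ↦ (2 : ℝ)) p := mdifferentiableAt_const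
  have h1 : MDiffAt (fun x ↦ 2 * θ x) p := hc.mul hθ
  have h2 : MDiffAt Real.exp (2 * θ p) := Real.differentiableAt_exp.mdifferentiableAt
  have h3 : ∀ y w : ℝ, mvfderiv 𝓘(ℝ, ℝ) Real.exp y w = Real.exp y * w := by
    intro y w
    have h : mvfderiv 𝓘(ℝ, ℝ) Real.exp y w = fderiv ℝ Real.exp y w := by
      rw [← mfderiv_eq_fderiv]
      rfl
    rw [h, fderiv_eq_smul_deriv, Real.deriv_exp, smul_eq_mul, mul_comm]
  have h4 : mvfderiv I (fun x ↦ Real.exp (2 * θ x)) p v =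
      Real.exp (2 * θ p) * mvfderiv I (fun x ↦ 2 * θ x) p v :=
    (mvfderiv_comp_apply p h2 h1 v).trans (h3 _ _)
  rw [h4, mvfderiv_fun_mul hc hθ, mvfderiv_const]
  simp
  ring

/-- The derivative of a smooth function along a smooth vector field is smooth. -/
theorem contMDiffAt_mvfderiv_apply [IsManifold I ∞ M] {f : M → ℝ} {X : Π x, TangentSpace I x}
    {p : M} (hf : ContMDiffAt I 𝓘(ℝ, ℝ) ∞ f p)
    (hX : SmoothSectionAt I E (TangentSpace I : M → Type _) X p) :
    ContMDiffAt I 𝓘(ℝ, ℝ) ∞ (fun x ↦ mvfderiv I f x (X x)) p := by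
  have h := ContMDiffAt.clm_apply_of_inCoordinates (F₁ := E)
    (E₁ := (TangentSpace I : M → Type _)) (F₂ := ℝ) (E₂ := (TangentSpace 𝓘(ℝ, ℝ) : ℝ → Type _))
    (b₁ := fun x : M ↦ x) (b₂ := f) (m₀ := p) (n := ∞) (ϕ := fun x ↦ mfderiv I 𝓘(ℝ, ℝ) f x)
    (v := X) (hf.mfderiv_const (m := ∞) (by simp)) hX hf
  rw [contMDiffAt_totalSpace] at h
  exact h.2.congr_of_eventuallyEq (by simp; rfl)

end Functions

section Bundles

variable {E : Type*} [NormedAddCommGroup E] [NormedSpace ℝ E]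
  {H : Type*} [TopologicalSpace H] {I : ModelWithCorners ℝ E H}
  {M : Type*} [TopologicalSpace M] [ChartedSpace H M]
  {F : Type*} [NormedAddCommGroup F] [NormedSpace ℝ F]
  {A : M → Type*} [TopologicalSpace (TotalSpace F A)]
  [∀ x, TopologicalSpace (A x)] [FiberBundle F A]

theorem SmoothSectionAt.mdifferentiableAt {s : Π x, A x} {p : M}
    (hs : SmoothSectionAt I F A s p) :
    MDifferentiableAt I (I.prod 𝓘(ℝ, F)) (fun x ↦ TotalSpace.mk' F x (s x)) p :=
  ContMDiffAt.mdifferentiableAt hs (by simp)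

variable [∀ x, AddCommGroup (A x)]

theorem smoothSectionAt_extend {p : M} (v : A p) :
    SmoothSectionAt I F A (FiberBundle.extend F v) p :=
  FiberBundle.contMDiffAt_extend I F v

variable [∀ x, Module ℝ (A x)] [VectorBundle ℝ F A]

theorem SmoothSectionAt.add {s t : Π x, A x} {p : M} (hs : SmoothSectionAt I F A s p)
    (ht : SmoothSectionAt I F A t p) : SmoothSectionAt I F A (s + t) p :=
  ContMDiffAt.add_section hs ht

theorem SmoothSectionAt.smul {f : M → ℝ} {s : Π x, A x} {p : M} (hf : ContMDiffAt I 𝓘(ℝ, ℝ) ∞ f p)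
    (hs : SmoothSectionAt I F A s p) : SmoothSectionAt I F A (f • s) p :=
  ContMDiffAt.smul_section hf hs

variable [ContMDiffVectorBundle ∞ F A I]

theorem SmoothSectionAt.eventually_mdifferentiableAt [IsManifold I 1 M] {s : Π x, A x} {p : M}
    (hs : SmoothSectionAt I F A s p) :
    ∀ᶠ x in nhds p, MDifferentiableAt I (I.prod 𝓘(ℝ, F)) (fun x ↦ TotalSpace.mk' F x (s x)) x :=
  GradedGeometry.eventually_mdifferentiableAt hs

variable [FiniteDimensional ℝ F]

theorem SemiRiemannianMetric.mdifferentiableAt (g : SemiRiemannianMetric I F A) {s t : Π x, A x}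
    {p : M}
    (hs : MDifferentiableAt I (I.prod 𝓘(ℝ, F)) (fun x ↦ TotalSpace.mk' F x (s x)) p)
    (ht : MDifferentiableAt I (I.prod 𝓘(ℝ, F)) (fun x ↦ TotalSpace.mk' F x (t x)) p) :
    MDifferentiableAt I 𝓘(ℝ, ℝ) (fun x ↦ g.val x (s x) (t x)) p := by
  set e := trivializationAt F A p
  have hp : p ∈ e.baseSet := FiberBundle.mem_baseSet_trivializationAt F A p
  set b := Basis.ofVectorSpace ℝ F
  have he (i) : SmoothSectionAt I F A (e.localFrame b i) p :=
    contMDiffAt_localFrame_of_mem ∞ _ b i hp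
  have hc {s : Π x, A x}
      (hs : MDifferentiableAt I (I.prod 𝓘(ℝ, F)) (fun x ↦ TotalSpace.mk' F x (s x)) p) (i) :
      MDifferentiableAt I 𝓘(ℝ, ℝ) (fun x ↦ e.localFrameCoeff I b i x (s x)) p :=
    mdifferentiableAt_localFrameCoeff b hp hs i
  have hsum : MDifferentiableAt I 𝓘(ℝ, ℝ) (fun x ↦ ∑ i, ∑ j, e.localFrameCoeff I b i x (s x) *
      (e.localFrameCoeff I b j x (t x) * g.val x (e.localFrame b i x) (e.localFrame b j x))) p :=
    mdifferentiableAt_fun_sum fun i ↦ mdifferentiableAt_fun_sum fun j ↦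
      (hc hs i).mul ((hc ht j).mul ((g.smooth p _ _ (he i) (he j)).mdifferentiableAt (by simp)))
  refine hsum.congr_of_eventuallyEq ?_
  filter_upwards [e.eventually_eq_localFrame_sum_coeff_smul (I := I) (s := s) b hp,
    e.eventually_eq_localFrame_sum_coeff_smul (I := I) (s := t) b hp] with x h1 h2
  conv_lhs => rw [h1, h2]
  simp only [map_sum, LinearMap.sum_apply, map_smul, Finset.mul_sum, LinearMap.smul_apply,
    smul_eq_mul]
  rw [Finset.sum_comm]
  refine Finset.sum_congr rfl fun i _ ↦ ?_
  exact Finset.sum_congr rfl fun j _ ↦ by ring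

/-- A section is smooth as soon as its products with all smooth sections are smooth: its coordinates
in a local frame solve a linear system whose matrix is the Gram matrix of the frame. -/
theorem SemiRiemannianMetric.smoothSectionAt_of_pairing (g : SemiRiemannianMetric I F A)
    {s : Π x, A x} {p : M}
    (h : ∀ t : Π x, A x, SmoothSectionAt I F A t p →
      ContMDiffAt I 𝓘(ℝ, ℝ) ∞ (fun x ↦ g.val x (s x) (t x)) p) :
    SmoothSectionAt I F A s p := by
  classical
  set e := trivializationAt F A p
  have hp : p ∈ e.baseSet := FiberBundle.mem_baseSet_trivializationAt F A p
  set b := Basis.ofVectorSpace ℝ F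
  have he (i) : SmoothSectionAt I F A (e.localFrame b i) p :=
    contMDiffAt_localFrame_of_mem ∞ _ b i hp
  refine (contMDiffAt_iff_localFrameCoeff (I := I) b hp).2 fun i ↦ ?_
  refine contMDiffAt_of_mulVec
    (G := fun x ↦ Matrix.of fun i j ↦ g.val x (e.localFrame b i x) (e.localFrame b j x))
    (c := fun x i ↦ e.localFrameCoeff I b i x (s x)) (fun i j ↦ g.smooth p _ _ (he i) (he j))
    ?_ (fun i ↦ ?_) i
  · convert! (LinearMap.BilinForm.nondegenerate_iff_det_ne_zero (e.basisAt b hp)).1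
      (g.nondegenerate p) using 2
    ext i j
    simp [hp, LinearMap.BilinForm.toMatrix_apply]
  · refine (h _ (he i)).congr_of_eventuallyEq ?_
    filter_upwards [e.eventually_eq_localFrame_sum_coeff_smul (I := I) (s := s) b hp] with x hx
    rw [g.symm]
    conv_rhs => rw [hx]
    simp [Matrix.mulVec, dotProduct, mul_comm]

/-- An operation on smooth sections which is linear over smooth functions at `p` is given by a
linear map on the fibre at `p`. -/
theorem exists_linearMap_of_tensorial {W : Type*} [AddCommGroup W] [Module ℝ W]
    {Φ : (Π x, A x) → W} {p : M}
    (hadd : ∀ s t : Π x, A x, SmoothSectionAt I F A s p → SmoothSectionAt I F A t p →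
      Φ (s + t) = Φ s + Φ t)
    (hsmul : ∀ (f : M → ℝ) (s : Π x, A x), ContMDiffAt I 𝓘(ℝ, ℝ) ∞ f p →
      SmoothSectionAt I F A s p → Φ (f • s) = f p • Φ s) :
    ∃ L : A p →ₗ[ℝ] W, ∀ s : Π x, A x, SmoothSectionAt I F A s p → L (s p) = Φ s := by
  classical
  set e := trivializationAt F A p
  have hp : p ∈ e.baseSet := FiberBundle.mem_baseSet_trivializationAt F A p
  set b := Basis.ofVectorSpace ℝ F
  have he (i) : SmoothSectionAt I F A (e.localFrame b i) p :=
    contMDiffAt_localFrame_of_mem ∞ _ b i hp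
  have hzero : SmoothSectionAt I F A 0 p := contMDiff_zeroSection ℝ A p
  have h0 : Φ 0 = 0 := by
    simpa using hsmul 0 0 contMDiffAt_const hzero
  -- An operation linear over functions sees only the germ: multiply by the indicator function of
  -- the set where the two sections agree.
  have hlocal : ∀ s t : Π x, A x, SmoothSectionAt I F A s p → SmoothSectionAt I F A t p →
      (∀ᶠ x in nhds p, s x = t x) → Φ s = Φ t := by
    intro s t hs ht hst
    let ψ (x : M) : ℝ := if s x = t x then 1 else 0
    have hψ : ContMDiffAt I 𝓘(ℝ, ℝ) ∞ ψ p :=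
      (contMDiffAt_const (c := (1 : ℝ))).congr_of_eventuallyEq
        (hst.mono fun x hx ↦ by simp [ψ, hx])
    have hψp : ψ p = 1 := by simp [ψ, hst.self_of_nhds]
    have hmul : ψ • s = ψ • t := by
      ext x
      by_cases hx : s x = t x <;> simp [ψ, hx]
    have h1 := hsmul ψ s hψ hs
    rw [hmul, hsmul ψ t hψ ht, hψp, one_smul, one_smul] at h1
    exact h1.symm
  have hsum : ∀ (J : Finset (Basis.ofVectorSpaceIndex ℝ F)) (σ : _ → Π x, A x),
      (∀ i ∈ J, SmoothSectionAt I F A (σ i) p) →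
      SmoothSectionAt I F A (∑ i ∈ J, σ i) p ∧ Φ (∑ i ∈ J, σ i) = ∑ i ∈ J, Φ (σ i) := by
    intro J σ
    induction J using Finset.induction_on with
    | empty => exact fun _ ↦ ⟨hzero, h0⟩
    | insert i J hi ih =>
      intro hσ
      obtain ⟨h1, h2⟩ := ih fun j hj ↦ hσ j (Finset.mem_insert_of_mem hj)
      have h3 := hσ i (Finset.mem_insert_self i J)
      rw [Finset.sum_insert hi, Finset.sum_insert hi]
      exact ⟨h3.add h1, by rw [hadd _ _ h3 h1, h2]⟩
  refine ⟨∑ i, (e.localFrameCoeff I b i p).smulRight (Φ (e.localFrame b i)), fun s hs ↦ ?_⟩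
  have hc (i) : ContMDiffAt I 𝓘(ℝ, ℝ) ∞ (fun x ↦ e.localFrameCoeff I b i x (s x)) p :=
    contMDiffAt_localFrameCoeff b hp hs i
  have hσ (i) := SmoothSectionAt.smul (hc i) (he i)
  obtain ⟨h1, h2⟩ := hsum Finset.univ _ fun i _ ↦ hσ i
  rw [hlocal s _ hs h1, h2]
  · simp [hsmul _ _ (hc _) (he _)]
  · filter_upwards [e.eventually_eq_localFrame_sum_coeff_smul (I := I) (s := s) b hp] with x hx
    rw [Finset.sum_apply]
    exact hx

end Bundles

/-! ### Levi-Civita connection of a semi-Riemannian metric on the tangent bundle -/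

section Koszul

variable {E : Type*} [NormedAddCommGroup E] [NormedSpace ℝ E]
  {H : Type*} [TopologicalSpace H] {I : ModelWithCorners ℝ E H}
  {M : Type*} [TopologicalSpace M] [ChartedSpace H M]
  {F : Type*} [NormedAddCommGroup F] [NormedSpace ℝ F]
  {A : M → Type*} [TopologicalSpace (TotalSpace F A)]
  [∀ x, AddCommGroup (A x)] [∀ x, Module ℝ (A x)] [∀ x, TopologicalSpace (A x)]
  [FiberBundle F A]

theorem SemiRiemannianMetric.ext_of_pairing (g : SemiRiemannianMetric I F A) {p : M} {v w : A p}
    (h : ∀ u, g.val p v u = g.val p w u) : v = w := by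
  rw [← sub_eq_zero]
  exact (g.nondegenerate p).1 _ fun u ↦ by rw [map_sub, LinearMap.sub_apply, h, sub_self]

/-- A vector satisfying the Koszul formula is the value of the Levi-Civita connection. -/
theorem leviCivita_eq_of_koszul {𝔞 : AlgebroidOps I A} {g : SemiRiemannianMetric I F A}
    {X Y : Π x, A x} {p : M} {v : A p}
    (hv : ∀ Z : Π x, A x, SmoothSectionAt I F A Z p → 2 * g.val p v (Z p) = koszul 𝔞 g X Y Z p) :
    leviCivita 𝔞 g X Y p = v := by
  have h : ∃ v : A p, ∀ Z : Π x, A x, SmoothSectionAt I F A Z p →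
      2 * g.val p v (Z p) = koszul 𝔞 g X Y Z p := ⟨v, hv⟩
  rw [leviCivita, dif_pos h]
  refine g.ext_of_pairing fun u ↦ ?_
  have hu := smoothSectionAt_extend (I := I) (F := F) u
  have h1 := (h.choose_spec _ hu).trans (hv _ hu).symm
  simpa using h1

end Koszul

section LeviCivita

variable {E : Type*} [NormedAddCommGroup E] [NormedSpace ℝ E]
  {H : Type*} [TopologicalSpace H] {I : ModelWithCorners ℝ E H}
  {M : Type*} [TopologicalSpace M] [ChartedSpace H M] [IsManifold I ∞ M]
  (g : SemiRiemannianMetric I E (TangentSpace I : M → Type _))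
  {X X' Y Y' Z Z' : Π x : M, TangentSpace I x} {f : M → ℝ} {p : M}

theorem mvfderiv_metric_comm (X Y : Π x : M, TangentSpace I x) :
    mvfderiv I (fun x ↦ g.val x (X x) (Y x)) p = mvfderiv I (fun x ↦ g.val x (Y x) (X x)) p := by
  simp only [g.symm _ (X _)]

theorem koszul_tangent_apply (X Y Z : Π x : M, TangentSpace I x) :
    koszul (tangentOps I M) g X Y Z p =
      mvfderiv I (fun x ↦ g.val x (Y x) (Z x)) p (X p)
        + mvfderiv I (fun x ↦ g.val x (Z x) (X x)) p (Y p)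
        - mvfderiv I (fun x ↦ g.val x (X x) (Y x)) p (Z p)
        + g.val p (VectorField.mlieBracket I X Y p) (Z p)
        - g.val p (VectorField.mlieBracket I Y Z p) (X p)
        + g.val p (VectorField.mlieBracket I Z X p) (Y p) :=
  rfl

/-- The Koszul expression depends only on the germ of its second argument. -/
theorem koszul_congr_middle (h : ∀ᶠ x in nhds p, Y x = Y' x) :
    koszul (tangentOps I M) g X Y Z p = koszul (tangentOps I M) g X Y' Z p := by
  have h1 : (fun x ↦ g.val x (Y x) (Z x)) =ᶠ[nhds p] fun x ↦ g.val x (Y' x) (Z x) :=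
    h.mono fun x hx ↦ by simp only [hx]
  have h2 : (fun x ↦ g.val x (X x) (Y x)) =ᶠ[nhds p] fun x ↦ g.val x (X x) (Y' x) :=
    h.mono fun x hx ↦ by simp only [hx]
  have h3 : VectorField.mlieBracket I X Y p = VectorField.mlieBracket I X Y' p :=
    Filter.EventuallyEq.mlieBracket_vectorField_eq (Filter.EventuallyEq.refl _ _) h
  have h4 : VectorField.mlieBracket I Y Z p = VectorField.mlieBracket I Y' Z p :=
    Filter.EventuallyEq.mlieBracket_vectorField_eq h (Filter.EventuallyEq.refl _ _)
  rw [koszul_tangent_apply, koszul_tangent_apply, mvfderiv_congr h1, mvfderiv_congr h2, h3, h4,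
    h.self_of_nhds]

theorem koszul_add_koszul_swap :
    koszul (tangentOps I M) g X Y Z p + koszul (tangentOps I M) g X Z Y p =
      2 * mvfderiv I (fun x ↦ g.val x (Y x) (Z x)) p (X p) := by
  simp only [koszul_tangent_apply]
  rw [mvfderiv_metric_comm g Z Y, mvfderiv_metric_comm g Z X, mvfderiv_metric_comm g Y X,
    VectorField.mlieBracket_swap_apply (V := Y) (W := X),
    VectorField.mlieBracket_swap_apply (V := Z) (W := X),
    VectorField.mlieBracket_swap_apply (V := Z) (W := Y)]
  simp only [map_neg, LinearMap.neg_apply]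
  ring

variable [FiniteDimensional ℝ E]

theorem mvfderiv_metric_add_right (hX : MDiffAt (T% X) p) (hY : MDiffAt (T% Y) p)
    (hY' : MDiffAt (T% Y') p) :
    mvfderiv I (fun x ↦ g.val x (X x) ((Y + Y') x)) p =
      mvfderiv I (fun x ↦ g.val x (X x) (Y x)) p + mvfderiv I (fun x ↦ g.val x (X x) (Y' x)) p := by
  simp only [Pi.add_apply, map_add]
  exact mvfderiv_fun_add (g.mdifferentiableAt hX hY) (g.mdifferentiableAt hX hY')

theorem mvfderiv_metric_smul_right (hX : MDiffAt (T% X) p) (hY : MDiffAt (T% Y) p)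
    (hf : MDiffAt f p) :
    mvfderiv I (fun x ↦ g.val x (X x) ((f • Y) x)) p =
      f p • mvfderiv I (fun x ↦ g.val x (X x) (Y x)) p + g.val p (X p) (Y p) • mvfderiv I f p := by
  simp only [Pi.smul_apply', map_smul, smul_eq_mul]
  exact mvfderiv_fun_mul hf (g.mdifferentiableAt hX hY)

theorem mvfderiv_metric_add_left (hX : MDiffAt (T% X) p) (hX' : MDiffAt (T% X') p)
    (hY : MDiffAt (T% Y) p) :
    mvfderiv I (fun x ↦ g.val x ((X + X') x) (Y x)) p =
      mvfderiv I (fun x ↦ g.val x (X x) (Y x)) p + mvfderiv I (fun x ↦ g.val x (X' x) (Y x)) p := by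
  rw [mvfderiv_metric_comm, mvfderiv_metric_add_right g hY hX hX', mvfderiv_metric_comm,
    mvfderiv_metric_comm g Y X']

theorem mvfderiv_metric_smul_left (hX : MDiffAt (T% X) p) (hY : MDiffAt (T% Y) p)
    (hf : MDiffAt f p) :
    mvfderiv I (fun x ↦ g.val x ((f • X) x) (Y x)) p =
      f p • mvfderiv I (fun x ↦ g.val x (X x) (Y x)) p + g.val p (X p) (Y p) • mvfderiv I f p := by
  rw [mvfderiv_metric_comm, mvfderiv_metric_smul_right g hY hX hf, mvfderiv_metric_comm,
    g.symm p (Y p)]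

theorem koszul_add_left (hX : MDiffAt (T% X) p) (hX' : MDiffAt (T% X') p) (hY : MDiffAt (T% Y) p)
    (hZ : MDiffAt (T% Z) p) :
    koszul (tangentOps I M) g (X + X') Y Z p =
      koszul (tangentOps I M) g X Y Z p + koszul (tangentOps I M) g X' Y Z p := by
  simp only [koszul_tangent_apply]
  rw [mvfderiv_metric_add_right g hZ hX hX', mvfderiv_metric_add_left g hX hX' hY,
    VectorField.mlieBracket_add_left hX hX', VectorField.mlieBracket_add_right hX hX']
  simp only [Pi.add_apply, map_add, LinearMap.add_apply, add_apply]
  ring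

theorem koszul_smul_left (hf : MDiffAt f p) (hX : MDiffAt (T% X) p) (hY : MDiffAt (T% Y) p)
    (hZ : MDiffAt (T% Z) p) :
    koszul (tangentOps I M) g (f • X) Y Z p = f p * koszul (tangentOps I M) g X Y Z p := by
  simp only [koszul_tangent_apply]
  rw [mvfderiv_metric_smul_right g hZ hX hf, mvfderiv_metric_smul_left g hX hY hf,
    VectorField.mlieBracket_smul_left hf hX, VectorField.mlieBracket_smul_right hf hX]
  simp only [Pi.smul_apply', map_add, map_smul, LinearMap.add_apply, LinearMap.smul_apply,
    add_apply, smul_apply, smul_eq_mul, neg_smul, map_neg,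
    LinearMap.neg_apply, g.symm p (Z p) (X p)]
  ring

theorem koszul_add_middle (hX : MDiffAt (T% X) p) (hY : MDiffAt (T% Y) p)
    (hY' : MDiffAt (T% Y') p) (hZ : MDiffAt (T% Z) p) :
    koszul (tangentOps I M) g X (Y + Y') Z p =
      koszul (tangentOps I M) g X Y Z p + koszul (tangentOps I M) g X Y' Z p := by
  simp only [koszul_tangent_apply]
  rw [mvfderiv_metric_add_right g hX hY hY', mvfderiv_metric_add_left g hY hY' hZ,
    VectorField.mlieBracket_add_left hY hY', VectorField.mlieBracket_add_right hY hY']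
  simp only [Pi.add_apply, map_add, LinearMap.add_apply, add_apply]
  ring

theorem koszul_smul_middle (hf : MDiffAt f p) (hX : MDiffAt (T% X) p) (hY : MDiffAt (T% Y) p)
    (hZ : MDiffAt (T% Z) p) :
    koszul (tangentOps I M) g X (f • Y) Z p =
      f p * koszul (tangentOps I M) g X Y Z p
        + 2 * (mvfderiv I f p (X p) * g.val p (Y p) (Z p)) := by
  simp only [koszul_tangent_apply]
  rw [mvfderiv_metric_smul_right g hX hY hf, mvfderiv_metric_smul_left g hY hZ hf,
    VectorField.mlieBracket_smul_left hf hY, VectorField.mlieBracket_smul_right hf hY]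
  simp only [Pi.smul_apply', map_add, map_smul, LinearMap.add_apply, LinearMap.smul_apply,
    add_apply, smul_apply, smul_eq_mul, neg_smul, map_neg,
    LinearMap.neg_apply, g.symm p (Y p) (X p)]
  ring

/-- The Koszul expression is linear over functions in its last argument, and therefore represented by
a vector. -/
theorem tensorialAt_koszul (hX : MDiffAt (T% X) p) (hY : MDiffAt (T% Y) p) :
    TensorialAt I E (fun Z ↦ koszul (tangentOps I M) g X Y Z p) p where
  smul {f Z} hf hZ := by
    simp only [koszul_tangent_apply]
    rw [mvfderiv_metric_smul_right g hY hZ hf, mvfderiv_metric_smul_left g hZ hX hf,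
      VectorField.mlieBracket_smul_left hf hZ, VectorField.mlieBracket_smul_right hf hZ]
    simp only [Pi.smul_apply', map_add, map_smul, LinearMap.add_apply, LinearMap.smul_apply,
      add_apply, smul_apply, smul_eq_mul, neg_smul, map_neg,
      LinearMap.neg_apply, g.symm p (Z p) (Y p)]
    ring
  add {Z Z'} hZ hZ' := by
    simp only [koszul_tangent_apply]
    rw [mvfderiv_metric_add_right g hY hZ hZ', mvfderiv_metric_add_left g hZ hZ' hX,
      VectorField.mlieBracket_add_left hZ hZ', VectorField.mlieBracket_add_right hZ hZ']
    simp only [Pi.add_apply, map_add, LinearMap.add_apply, add_apply]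
    ring

/-- The vector `♯φ` representing a linear form `φ` on a tangent space: `g(♯φ, w) = φ(w)`. -/
def sharp {p : M} (φ : TangentSpace I p →ₗ[ℝ] ℝ) : TangentSpace I p :=
  haveI : FiniteDimensional ℝ (TangentSpace I p) := inferInstanceAs (FiniteDimensional ℝ E)
  ((g.val p).toDual (g.nondegenerate p)).symm φ

@[simp] theorem val_sharp {p : M} (φ : TangentSpace I p →ₗ[ℝ] ℝ) (w : TangentSpace I p) :
    g.val p (sharp g φ) w = φ w :=
  haveI : FiniteDimensional ℝ (TangentSpace I p) := inferInstanceAs (FiniteDimensional ℝ E)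
  LinearMap.BilinForm.apply_toDual_symm_apply ..

/-- The Levi-Civita connection of a semi-Riemannian metric on the tangent bundle. -/
abbrev cov (X Y : Π x : M, TangentSpace I x) : Π x : M, TangentSpace I x :=
  leviCivita (tangentOps I M) g X Y

/-- The Koszul formula holds for vector fields that are merely differentiable at the point. -/
theorem two_mul_val_cov (hX : MDiffAt (T% X) p) (hY : MDiffAt (T% Y) p) (hZ : MDiffAt (T% Z) p) :
    2 * g.val p (cov g X Y p) (Z p) = koszul (tangentOps I M) g X Y Z p := by
  have hT := tensorialAt_koszul g hX hY
  set v : TangentSpace I p := (2 : ℝ)⁻¹ • sharp g (TensorialAt.mkHom _ p hT).toLinearMap with hv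
  have h : ∀ Z : Π x : M, TangentSpace I x, MDiffAt (T% Z) p →
      2 * g.val p v (Z p) = koszul (tangentOps I M) g X Y Z p := by
    intro Z hZ
    rw [hv, map_smul, LinearMap.smul_apply, val_sharp, smul_eq_mul,
      mul_inv_cancel_left₀ two_ne_zero]
    exact TensorialAt.mkHom_apply hT hZ
  rw [cov, leviCivita_eq_of_koszul fun Z hZ ↦ h Z hZ.mdifferentiableAt, h Z hZ]

theorem cov_add_left (hX : MDiffAt (T% X) p) (hX' : MDiffAt (T% X') p) (hY : MDiffAt (T% Y) p) :
    cov g (X + X') Y p = cov g X Y p + cov g X' Y p := by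
  refine leviCivita_eq_of_koszul fun Z hZ ↦ ?_
  have hZ := hZ.mdifferentiableAt
  rw [koszul_add_left g hX hX' hY hZ, ← two_mul_val_cov g hX hY hZ, ← two_mul_val_cov g hX' hY hZ,
    map_add, LinearMap.add_apply, mul_add]

theorem cov_smul_left (hf : MDiffAt f p) (hX : MDiffAt (T% X) p) (hY : MDiffAt (T% Y) p) :
    cov g (f • X) Y p = f p • cov g X Y p := by
  refine leviCivita_eq_of_koszul fun Z hZ ↦ ?_
  have hZ := hZ.mdifferentiableAt
  rw [koszul_smul_left g hf hX hY hZ, ← two_mul_val_cov g hX hY hZ, map_smul, LinearMap.smul_apply,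
    smul_eq_mul, mul_left_comm]

theorem cov_add_right (hX : MDiffAt (T% X) p) (hY : MDiffAt (T% Y) p) (hY' : MDiffAt (T% Y') p) :
    cov g X (Y + Y') p = cov g X Y p + cov g X Y' p := by
  refine leviCivita_eq_of_koszul fun Z hZ ↦ ?_
  have hZ := hZ.mdifferentiableAt
  rw [koszul_add_middle g hX hY hY' hZ, ← two_mul_val_cov g hX hY hZ,
    ← two_mul_val_cov g hX hY' hZ, map_add, LinearMap.add_apply, mul_add]

/-- The Leibniz rule. -/
theorem cov_smul_right (hf : MDiffAt f p) (hX : MDiffAt (T% X) p) (hY : MDiffAt (T% Y) p) :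
    cov g X (f • Y) p = f p • cov g X Y p + mvfderiv I f p (X p) • Y p := by
  refine leviCivita_eq_of_koszul fun Z hZ ↦ ?_
  have hZ := hZ.mdifferentiableAt
  rw [koszul_smul_middle g hf hX hY hZ, ← two_mul_val_cov g hX hY hZ, map_add, map_smul, map_smul,
    LinearMap.add_apply, LinearMap.smul_apply, LinearMap.smul_apply, smul_eq_mul, smul_eq_mul]
  ring

/-- The Levi-Civita connection is compatible with the metric. -/
theorem cov_metric (hX : MDiffAt (T% X) p) (hY : MDiffAt (T% Y) p) (hZ : MDiffAt (T% Z) p) :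
    mvfderiv I (fun x ↦ g.val x (Y x) (Z x)) p (X p) =
      g.val p (cov g X Y p) (Z p) + g.val p (Y p) (cov g X Z p) := by
  have h1 := two_mul_val_cov g hX hY hZ
  have h2 := two_mul_val_cov g hX hZ hY
  have h3 := koszul_add_koszul_swap g (X := X) (Y := Y) (Z := Z) (p := p)
  rw [g.symm p (Y p)]
  linarith

/-- The covariant derivative depends on the differentiated field only through its germ. -/
theorem cov_congr_right (hX : MDiffAt (T% X) p) (hY' : MDiffAt (T% Y') p)
    (h : ∀ᶠ x in nhds p, Y x = Y' x) : cov g X Y p = cov g X Y' p :=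
  leviCivita_eq_of_koszul fun Z hZ ↦ by
    rw [koszul_congr_middle g h, two_mul_val_cov g hX hY' hZ.mdifferentiableAt]

/-- The covariant derivative depends on the direction field only through its value at the point. -/
theorem cov_congr_left (h : X p = X' p) (hX : MDiffAt (T% X) p) (hX' : MDiffAt (T% X') p)
    (hY : MDiffAt (T% Y) p) : cov g X Y p = cov g X' Y p :=
  TensorialAt.pointwise (Φ := fun X ↦ cov g X Y p) (I := I) (F := E)
    ⟨fun hf hX ↦ cov_smul_left g hf hX hY, fun hX hX' ↦ cov_add_left g hX hX' hY⟩ hX hX' h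

end LeviCivita

/-! ### Curvature tensor -/

section Tensors

variable {E : Type*} [NormedAddCommGroup E] [NormedSpace ℝ E]
  {H : Type*} [TopologicalSpace H] {I : ModelWithCorners ℝ E H}
  {M : Type*} [TopologicalSpace M] [ChartedSpace H M]
  {F : Type*} [NormedAddCommGroup F] [NormedSpace ℝ F]
  {A : M → Type*} [TopologicalSpace (TotalSpace F A)]
  [∀ x, AddCommGroup (A x)] [∀ x, Module ℝ (A x)] [∀ x, TopologicalSpace (A x)]
  [FiberBundle F A]

/-- A trilinear map agreeing with the curvature on smooth sections is the curvature tensor. -/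
theorem curvatureTensor_eq {𝔞 : AlgebroidOps I A} {g : SemiRiemannianMetric I F A} {p : M}
    {R : A p →ₗ[ℝ] A p →ₗ[ℝ] A p →ₗ[ℝ] A p}
    (hR : ∀ X Y Z : Π x, A x, SmoothSectionAt I F A X p → SmoothSectionAt I F A Y p →
      SmoothSectionAt I F A Z p → R (X p) (Y p) (Z p) = curvature 𝔞 g X Y Z p) :
    curvatureTensor 𝔞 g p = R := by
  have h : ∃ R : A p →ₗ[ℝ] A p →ₗ[ℝ] A p →ₗ[ℝ] A p, ∀ X Y Z : Π x, A x,
      SmoothSectionAt I F A X p → SmoothSectionAt I F A Y p → SmoothSectionAt I F A Z p →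
      R (X p) (Y p) (Z p) = curvature 𝔞 g X Y Z p := ⟨R, hR⟩
  rw [curvatureTensor, dif_pos h]
  refine LinearMap.ext fun u ↦ LinearMap.ext fun v ↦ LinearMap.ext fun w ↦ ?_
  have hs (u : A p) := smoothSectionAt_extend (I := I) (F := F) u
  have h1 := (h.choose_spec _ _ _ (hs u) (hs v) (hs w)).trans (hR _ _ _ (hs u) (hs v) (hs w)).symm
  simpa using h1

/-- A bilinear form agreeing with the Hessian on smooth sections is the Hessian tensor. -/
theorem hessian_eq {𝔞 : AlgebroidOps I A} {g : SemiRiemannianMetric I F A} {f : M → ℝ} {p : M}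
    {B : LinearMap.BilinForm ℝ (A p)}
    (hB : ∀ X Y : Π x, A x, SmoothSectionAt I F A X p → SmoothSectionAt I F A Y p →
      B (X p) (Y p) = hessianField 𝔞 g f X Y p) :
    hessian 𝔞 g f p = B := by
  have h : ∃ B : LinearMap.BilinForm ℝ (A p), ∀ X Y : Π x, A x,
      SmoothSectionAt I F A X p → SmoothSectionAt I F A Y p →
      B (X p) (Y p) = hessianField 𝔞 g f X Y p := ⟨B, hB⟩
  rw [hessian, dif_pos h]
  refine LinearMap.ext fun u ↦ LinearMap.ext fun v ↦ ?_
  have hs (u : A p) := smoothSectionAt_extend (I := I) (F := F) u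
  have h1 := (h.choose_spec _ _ (hs u) (hs v)).trans (hB _ _ (hs u) (hs v)).symm
  simpa using h1

end Tensors

section Curvature

variable {E : Type*} [NormedAddCommGroup E] [NormedSpace ℝ E]
  {H : Type*} [TopologicalSpace H] {I : ModelWithCorners ℝ E H}
  {M : Type*} [TopologicalSpace M] [ChartedSpace H M] [IsManifold I ∞ M]

/-- The vector field `X` is smooth at the point `p`. -/
abbrev SmoothFieldAt (X : Π x : M, TangentSpace I x) (p : M) : Prop :=
  SmoothSectionAt I E (TangentSpace I : M → Type _) X p

variable (g : SemiRiemannianMetric I E (TangentSpace I : M → Type _))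
  {X X' Y Y' Z Z' : Π x : M, TangentSpace I x} {f : M → ℝ} {p : M}

theorem curvature_tangent_apply (X Y Z : Π x : M, TangentSpace I x) :
    curvature (tangentOps I M) g X Y Z p =
      cov g X (cov g Y Z) p - cov g Y (cov g X Z) p
        - cov g (VectorField.mlieBracket I X Y) Z p :=
  rfl

variable [FiniteDimensional ℝ E]

theorem SmoothFieldAt.mlieBracket (hX : SmoothFieldAt X p) (hY : SmoothFieldAt Y p) :
    SmoothFieldAt (VectorField.mlieBracket I X Y) p := by
  have : IsManifold I ((⊤ : ℕ∞) + 1) M := ‹IsManifold I ∞ M›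
  have : IsManifold I (minSmoothness ℝ 2) M := by
    rw [minSmoothness_of_isRCLikeNormedField]
    infer_instance
  exact ContMDiffAt.mlieBracket_vectorField (n := ⊤) (m := ⊤) hX hY (by simp)

theorem SmoothFieldAt.cov (hX : SmoothFieldAt X p) (hY : SmoothFieldAt Y p) :
    SmoothFieldAt (cov g X Y) p := by
  refine g.smoothSectionAt_of_pairing fun Z hZ ↦ ?_
  have hk : ContMDiffAt I 𝓘(ℝ, ℝ) ∞
      (fun x ↦ (2 : ℝ)⁻¹ * koszul (tangentOps I M) g X Y Z x) p := by
    refine contMDiffAt_const.mul (((((ContMDiffAt.add ?_ ?_).sub ?_).add ?_).sub ?_).add ?_)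
    · exact contMDiffAt_mvfderiv_apply (g.smooth p _ _ hY hZ) hX
    · exact contMDiffAt_mvfderiv_apply (g.smooth p _ _ hZ hX) hY
    · exact contMDiffAt_mvfderiv_apply (g.smooth p _ _ hX hY) hZ
    · exact g.smooth p _ _ (hX.mlieBracket hY) hZ
    · exact g.smooth p _ _ (hY.mlieBracket hZ) hX
    · exact g.smooth p _ _ (SmoothFieldAt.mlieBracket hZ hX) hY
  refine hk.congr_of_eventuallyEq ?_
  filter_upwards [hX.eventually_mdifferentiableAt, hY.eventually_mdifferentiableAt,
    hZ.eventually_mdifferentiableAt] with x h1 h2 h3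
  rw [← two_mul_val_cov g h1 h2 h3, inv_mul_cancel_left₀ two_ne_zero]

/-- The Lie bracket acts on functions as the commutator of derivations. Comparing the coefficients
of `Z` in the Jacobi identity for `X`, `Y`, `fZ` yields the claim if `Z` does not vanish. -/
theorem mvfderiv_mlieBracket (hX : SmoothFieldAt X p) (hY : SmoothFieldAt Y p)
    (hf : ContMDiffAt I 𝓘(ℝ, ℝ) ∞ f p) :
    mvfderiv I f p (VectorField.mlieBracket I X Y p) =
      mvfderiv I (fun x ↦ mvfderiv I f x (Y x)) p (X p)
        - mvfderiv I (fun x ↦ mvfderiv I f x (X x)) p (Y p) := by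
  have : IsManifold I (minSmoothness ℝ 3) M := by
    rw [minSmoothness_of_isRCLikeNormedField]
    infer_instance
  have htwo : minSmoothness ℝ 2 ≤ ∞ := by
    rw [minSmoothness_of_isRCLikeNormedField]
    exact ENat.LEInfty.out
  -- If the tangent space is zero there is no nonvanishing field, but both sides vanish.
  by_cases htriv : ∀ v : TangentSpace I p, v = 0
  · rw [htriv (VectorField.mlieBracket I X Y p), htriv (X p), htriv (Y p)]
    simp
  push Not at htriv
  obtain ⟨v, hv⟩ := htriv
  set Z : Π x : M, TangentSpace I x := FiberBundle.extend E v
  have hZ : SmoothFieldAt Z p := smoothSectionAt_extend v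
  have hbr : ∀ {X : Π x : M, TangentSpace I x}, SmoothFieldAt X p →
      VectorField.mlieBracket I X (f • Z) =ᶠ[nhds p]
        (fun x ↦ mvfderiv I f x (X x)) • Z + f • VectorField.mlieBracket I X Z := by
    intro X hX
    filter_upwards [eventually_mdifferentiableAt hf, hZ.eventually_mdifferentiableAt] with x h1 h2
    exact VectorField.mlieBracket_smul_right h1 h2
  have hdX := contMDiffAt_mvfderiv_apply hf hX
  have hdY := contMDiffAt_mvfderiv_apply hf hY
  have hexp : ∀ {X Y : Π x : M, TangentSpace I x}, SmoothFieldAt X p → SmoothFieldAt Y p →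
      VectorField.mlieBracket I X (VectorField.mlieBracket I Y (f • Z)) p =
        (mvfderiv I (fun x ↦ mvfderiv I f x (Y x)) p (X p) • Z p
          + mvfderiv I f p (Y p) • VectorField.mlieBracket I X Z p)
        + (mvfderiv I f p (X p) • VectorField.mlieBracket I Y Z p
          + f p • VectorField.mlieBracket I X (VectorField.mlieBracket I Y Z) p) := by
    intro X Y hX hY
    have hd := contMDiffAt_mvfderiv_apply hf hY
    have hYZ := hY.mlieBracket hZ
    have h : VectorField.mlieBracket I X (VectorField.mlieBracket I Y (f • Z)) p =
        VectorField.mlieBracket I X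
          ((fun x ↦ mvfderiv I f x (Y x)) • Z + f • VectorField.mlieBracket I Y Z) p :=
      Filter.EventuallyEq.mlieBracket_vectorField_eq (Filter.EventuallyEq.refl _ _) (hbr hY)
    rw [h, VectorField.mlieBracket_add_right (SmoothSectionAt.smul hd hZ).mdifferentiableAt
        (SmoothSectionAt.smul hf hYZ).mdifferentiableAt,
      VectorField.mlieBracket_smul_right (hd.mdifferentiableAt (by simp)) hZ.mdifferentiableAt,
      VectorField.mlieBracket_smul_right (hf.mdifferentiableAt (by simp)) hYZ.mdifferentiableAt]
  have hJ (W : Π x : M, TangentSpace I x) (hW : SmoothFieldAt W p) :=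
    VectorField.leibniz_identity_mlieBracket_apply (I := I) (U := X) (V := Y) (W := W) (x := p)
      (hX.of_le htwo) (hY.of_le htwo) (hW.of_le htwo)
  have h1 := hJ _ (SmoothSectionAt.smul hf hZ)
  rw [hexp hX hY, hexp hY hX, hJ Z hZ,
    VectorField.mlieBracket_smul_right (hf.mdifferentiableAt (by simp)) hZ.mdifferentiableAt] at h1
  have hZp : Z p = v := FiberBundle.extend_apply_self E v
  rw [hZp] at h1
  have h2 : (mvfderiv I f p (VectorField.mlieBracket I X Y p)
      - (mvfderiv I (fun x ↦ mvfderiv I f x (Y x)) p (X p)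
        - mvfderiv I (fun x ↦ mvfderiv I f x (X x)) p (Y p))) • v = 0 := by
    linear_combination (norm := module) (-1 : ℝ) • h1
  exact sub_eq_zero.1 ((smul_eq_zero.1 h2).resolve_right hv)

theorem cov_neg_left (hX : MDiffAt (T% X) p) (hY : MDiffAt (T% Y) p) :
    cov g (-X) Y p = -cov g X Y p := by
  have h := cov_smul_left g (f := fun _ ↦ -1) mdifferentiableAt_const hX hY
  have hX' : (fun _ : M ↦ (-1 : ℝ)) • X = -X := by ext; simp
  rwa [hX', neg_one_smul] at h

theorem curvature_swap (hX : SmoothFieldAt X p) (hY : SmoothFieldAt Y p)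
    (hZ : SmoothFieldAt Z p) :
    curvature (tangentOps I M) g X Y Z p = -curvature (tangentOps I M) g Y X Z p := by
  rw [curvature_tangent_apply, curvature_tangent_apply, VectorField.mlieBracket_swap,
    cov_neg_left g (hY.mlieBracket hX).mdifferentiableAt hZ.mdifferentiableAt]
  abel

theorem curvature_add_left (hX : SmoothFieldAt X p) (hX' : SmoothFieldAt X' p)
    (hY : SmoothFieldAt Y p) (hZ : SmoothFieldAt Z p) :
    curvature (tangentOps I M) g (X + X') Y Z p =
      curvature (tangentOps I M) g X Y Z p + curvature (tangentOps I M) g X' Y Z p := by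
  have h1 : ∀ᶠ x in nhds p, cov g (X + X') Z x = (cov g X Z + cov g X' Z) x := by
    filter_upwards [hX.eventually_mdifferentiableAt, hX'.eventually_mdifferentiableAt,
      hZ.eventually_mdifferentiableAt] with x h1 h2 h3
    exact cov_add_left g h1 h2 h3
  have h2 : VectorField.mlieBracket I (X + X') Y p =
      (VectorField.mlieBracket I X Y + VectorField.mlieBracket I X' Y) p :=
    VectorField.mlieBracket_add_left hX.mdifferentiableAt hX'.mdifferentiableAt
  have hXZ := hX.cov g hZ
  have hXZ' := hX'.cov g hZ
  have hXY := hX.mlieBracket hY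
  have hXY' := hX'.mlieBracket hY
  simp only [curvature_tangent_apply]
  rw [cov_add_left g hX.mdifferentiableAt hX'.mdifferentiableAt (hY.cov g hZ).mdifferentiableAt,
    cov_congr_right g hY.mdifferentiableAt (hXZ.add hXZ').mdifferentiableAt h1,
    cov_add_right g hY.mdifferentiableAt hXZ.mdifferentiableAt hXZ'.mdifferentiableAt,
    cov_congr_left g h2 (SmoothFieldAt.mlieBracket (hX.add hX') hY).mdifferentiableAt
      (hXY.add hXY').mdifferentiableAt hZ.mdifferentiableAt,
    cov_add_left g hXY.mdifferentiableAt hXY'.mdifferentiableAt hZ.mdifferentiableAt]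
  abel

theorem curvature_smul_left (hf : ContMDiffAt I 𝓘(ℝ, ℝ) ∞ f p) (hX : SmoothFieldAt X p)
    (hY : SmoothFieldAt Y p) (hZ : SmoothFieldAt Z p) :
    curvature (tangentOps I M) g (f • X) Y Z p =
      f p • curvature (tangentOps I M) g X Y Z p := by
  have hf' := hf.mdifferentiableAt (by simp)
  have h1 : ∀ᶠ x in nhds p, cov g (f • X) Z x = (f • cov g X Z) x := by
    filter_upwards [hX.eventually_mdifferentiableAt, eventually_mdifferentiableAt hf,
      hZ.eventually_mdifferentiableAt] with x h1 h2 h3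
    exact cov_smul_left g h2 h1 h3
  have hd := contMDiffAt_mvfderiv_apply hf hY
  have h2 : VectorField.mlieBracket I (f • X) Y p =
      (-((fun x ↦ mvfderiv I f x (Y x)) • X) + f • VectorField.mlieBracket I X Y) p := by
    rw [VectorField.mlieBracket_smul_left hf' hX.mdifferentiableAt, neg_smul]
    rfl
  have hXZ := hX.cov g hZ
  have hXY := hX.mlieBracket hY
  have hdX := SmoothSectionAt.smul hd hX
  have hdX' : SmoothFieldAt (-((fun x ↦ mvfderiv I f x (Y x)) • X)) p :=
    ContMDiffAt.neg_section hdX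
  simp only [curvature_tangent_apply]
  rw [cov_smul_left g hf' hX.mdifferentiableAt (hY.cov g hZ).mdifferentiableAt,
    cov_congr_right g hY.mdifferentiableAt (SmoothSectionAt.smul hf hXZ).mdifferentiableAt h1,
    cov_smul_right g hf' hY.mdifferentiableAt hXZ.mdifferentiableAt,
    cov_congr_left g h2 (SmoothFieldAt.mlieBracket (SmoothSectionAt.smul hf hX) hY).mdifferentiableAt
      (hdX'.add (SmoothSectionAt.smul hf hXY)).mdifferentiableAt hZ.mdifferentiableAt,
    cov_add_left g hdX'.mdifferentiableAt (SmoothSectionAt.smul hf hXY).mdifferentiableAt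
      hZ.mdifferentiableAt,
    cov_neg_left g hdX.mdifferentiableAt hZ.mdifferentiableAt,
    cov_smul_left g (hd.mdifferentiableAt (by simp)) hX.mdifferentiableAt hZ.mdifferentiableAt,
    cov_smul_left g hf' hXY.mdifferentiableAt hZ.mdifferentiableAt]
  module

theorem curvature_add_right (hX : SmoothFieldAt X p) (hY : SmoothFieldAt Y p)
    (hZ : SmoothFieldAt Z p) (hZ' : SmoothFieldAt Z' p) :
    curvature (tangentOps I M) g X Y (Z + Z') p =
      curvature (tangentOps I M) g X Y Z p + curvature (tangentOps I M) g X Y Z' p := by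
  have h1 : ∀ {X Y : Π x : M, TangentSpace I x}, SmoothFieldAt X p → SmoothFieldAt Y p →
      cov g X (cov g Y (Z + Z')) p = cov g X (cov g Y Z) p + cov g X (cov g Y Z') p := by
    intro X Y hX hY
    have h : ∀ᶠ x in nhds p, cov g Y (Z + Z') x = (cov g Y Z + cov g Y Z') x := by
      filter_upwards [hY.eventually_mdifferentiableAt, hZ.eventually_mdifferentiableAt,
        hZ'.eventually_mdifferentiableAt] with x h1 h2 h3
      exact cov_add_right g h1 h2 h3
    rw [cov_congr_right g hX.mdifferentiableAt
      ((hY.cov g hZ).add (hY.cov g hZ')).mdifferentiableAt h, cov_add_right g hX.mdifferentiableAt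
      (hY.cov g hZ).mdifferentiableAt (hY.cov g hZ').mdifferentiableAt]
  simp only [curvature_tangent_apply]
  rw [h1 hX hY, h1 hY hX, cov_add_right g (hX.mlieBracket hY).mdifferentiableAt
    hZ.mdifferentiableAt hZ'.mdifferentiableAt]
  abel

/-- The second derivatives of `f` cancel by `mvfderiv_mlieBracket`. -/
theorem curvature_smul_right (hf : ContMDiffAt I 𝓘(ℝ, ℝ) ∞ f p) (hX : SmoothFieldAt X p)
    (hY : SmoothFieldAt Y p) (hZ : SmoothFieldAt Z p) :
    curvature (tangentOps I M) g X Y (f • Z) p =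
      f p • curvature (tangentOps I M) g X Y Z p := by
  have hf' := hf.mdifferentiableAt (by simp)
  have h1 : ∀ {X Y : Π x : M, TangentSpace I x}, SmoothFieldAt X p → SmoothFieldAt Y p →
      cov g X (cov g Y (f • Z)) p =
        (f p • cov g X (cov g Y Z) p + mvfderiv I f p (X p) • cov g Y Z p)
        + (mvfderiv I f p (Y p) • cov g X Z p
          + mvfderiv I (fun x ↦ mvfderiv I f x (Y x)) p (X p) • Z p) := by
    intro X Y hX hY
    have hd := contMDiffAt_mvfderiv_apply hf hY
    have hYZ := hY.cov g hZ
    have h : ∀ᶠ x in nhds p,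
        cov g Y (f • Z) x = (f • cov g Y Z + (fun x ↦ mvfderiv I f x (Y x)) • Z) x := by
      filter_upwards [hY.eventually_mdifferentiableAt, hZ.eventually_mdifferentiableAt,
        eventually_mdifferentiableAt hf] with x h1 h2 h3
      exact cov_smul_right g h3 h1 h2
    have h2 := SmoothSectionAt.smul hf hYZ
    have h3 := SmoothSectionAt.smul hd hZ
    rw [cov_congr_right g hX.mdifferentiableAt (h2.add h3).mdifferentiableAt h,
      cov_add_right g hX.mdifferentiableAt h2.mdifferentiableAt h3.mdifferentiableAt,
      cov_smul_right g hf' hX.mdifferentiableAt hYZ.mdifferentiableAt,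
      cov_smul_right g (hd.mdifferentiableAt (by simp)) hX.mdifferentiableAt hZ.mdifferentiableAt]
  simp only [curvature_tangent_apply]
  rw [h1 hX hY, h1 hY hX, cov_smul_right g hf' (hX.mlieBracket hY).mdifferentiableAt
    hZ.mdifferentiableAt, mvfderiv_mlieBracket hX hY hf]
  module

/-- The curvature of vector fields is tensorial, so that the curvature tensor of `g` computes it. -/
theorem curvatureTensor_tangent_apply (hX : SmoothFieldAt X p) (hY : SmoothFieldAt Y p)
    (hZ : SmoothFieldAt Z p) :
    curvatureTensor (tangentOps I M) g p (X p) (Y p) (Z p) =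
      curvature (tangentOps I M) g X Y Z p := by
  have hext (u : TangentSpace I p) :
      SmoothFieldAt (FiberBundle.extend E u : Π x : M, TangentSpace I x) p :=
    smoothSectionAt_extend u
  -- The three slots are turned into arguments of linear maps one at a time, the last slot first.
  have h1 : ∀ X Y : Π x : M, TangentSpace I x, ∃ L : TangentSpace I p →ₗ[ℝ] TangentSpace I p,
      SmoothFieldAt X p → SmoothFieldAt Y p → ∀ Z, SmoothFieldAt Z p →
        L (Z p) = curvature (tangentOps I M) g X Y Z p := by
    intro X Y
    by_cases hXY : SmoothFieldAt X p ∧ SmoothFieldAt Y p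
    · obtain ⟨L, hL⟩ := exists_linearMap_of_tensorial (I := I) (F := E) (p := p)
        (Φ := fun Z ↦ curvature (tangentOps I M) g X Y Z p)
        (fun _ _ hs ht ↦ curvature_add_right g hXY.1 hXY.2 hs ht)
        (fun _ _ hf hs ↦ curvature_smul_right g hf hXY.1 hXY.2 hs)
      exact ⟨L, fun _ _ ↦ hL⟩
    · exact ⟨0, fun hX hY ↦ absurd ⟨hX, hY⟩ hXY⟩
  choose L hL using h1
  have hLswap : ∀ X Y, SmoothFieldAt X p → SmoothFieldAt Y p → L X Y = -L Y X := by
    intro X Y hX hY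
    refine LinearMap.ext fun u ↦ ?_
    have h := curvature_swap g hX hY (hext u)
    rw [← hL X Y hX hY _ (hext u), ← hL Y X hY hX _ (hext u)] at h
    simpa using h
  have hLadd : ∀ X X' Y, SmoothFieldAt X p → SmoothFieldAt X' p → SmoothFieldAt Y p →
      L (X + X') Y = L X Y + L X' Y := by
    intro X X' Y hX hX' hY
    refine LinearMap.ext fun u ↦ ?_
    have h := curvature_add_left g hX hX' hY (hext u)
    rw [← hL X Y hX hY _ (hext u), ← hL X' Y hX' hY _ (hext u),
      ← hL _ Y (hX.add hX') hY _ (hext u)] at h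
    simpa using h
  have hLsmul : ∀ (f : M → ℝ) (X Y : Π x : M, TangentSpace I x), ContMDiffAt I 𝓘(ℝ, ℝ) ∞ f p →
      SmoothFieldAt X p → SmoothFieldAt Y p → L (f • X) Y = f p • L X Y := by
    intro f X Y hf hX hY
    refine LinearMap.ext fun u ↦ ?_
    have h := curvature_smul_left g hf hX hY (hext u)
    rw [← hL X Y hX hY _ (hext u), ← hL _ Y (SmoothSectionAt.smul hf hX) hY _ (hext u)] at h
    simpa using h
  have h2 : ∀ X : Π x : M, TangentSpace I x,
      ∃ K : TangentSpace I p →ₗ[ℝ] TangentSpace I p →ₗ[ℝ] TangentSpace I p,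
        SmoothFieldAt X p → ∀ Y, SmoothFieldAt Y p → K (Y p) = L X Y := by
    intro X
    by_cases hX : SmoothFieldAt X p
    · obtain ⟨K, hK⟩ := exists_linearMap_of_tensorial (I := I) (F := E) (p := p)
        (Φ := fun Y ↦ L X Y)
        (fun s t hs ht ↦ by
          rw [hLswap X _ hX (hs.add ht), hLadd s t X hs ht hX, hLswap X s hX hs, hLswap X t hX ht,
            neg_add])
        (fun f s hf hs ↦ by
          rw [hLswap X _ hX (SmoothSectionAt.smul hf hs), hLsmul f s X hf hs hX, hLswap X s hX hs,
            smul_neg])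
      exact ⟨K, fun _ ↦ hK⟩
    · exact ⟨0, fun h ↦ absurd h hX⟩
  choose K hK using h2
  obtain ⟨R, hR⟩ := exists_linearMap_of_tensorial (I := I) (F := E) (p := p) (Φ := K)
    (fun s t hs ht ↦ LinearMap.ext fun u ↦ by
      have hu : FiberBundle.extend E u p = u := FiberBundle.extend_apply_self E u
      rw [← hu, LinearMap.add_apply, hK _ (hs.add ht) _ (hext u), hK _ hs _ (hext u),
        hK _ ht _ (hext u), hLadd s t _ hs ht (hext u)])
    (fun f s hf hs ↦ LinearMap.ext fun u ↦ by
      have hu : FiberBundle.extend E u p = u := FiberBundle.extend_apply_self E u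
      rw [← hu, LinearMap.smul_apply, hK _ (SmoothSectionAt.smul hf hs) _ (hext u),
        hK _ hs _ (hext u), hLsmul f s _ hf hs (hext u)])
  have hR' : ∀ X Y Z : Π x : M, TangentSpace I x, SmoothFieldAt X p → SmoothFieldAt Y p →
      SmoothFieldAt Z p → R (X p) (Y p) (Z p) = curvature (tangentOps I M) g X Y Z p :=
    fun X Y Z hX hY hZ ↦ by rw [hR X hX, hK X hX Y hY, hL X Y hX hY Z hZ]
  rw [curvatureTensor_eq hR', hR' X Y Z hX hY hZ]

end Curvature

/-! ### Gradient, Hessian and the tensor `T̃` -/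

section Hessian

variable {E : Type*} [NormedAddCommGroup E] [NormedSpace ℝ E] [FiniteDimensional ℝ E]
  {H : Type*} [TopologicalSpace H] {I : ModelWithCorners ℝ E H}
  {M : Type*} [TopologicalSpace M] [ChartedSpace H M] [IsManifold I ∞ M]
  (g : SemiRiemannianMetric I E (TangentSpace I : M → Type _))
  {X Y : Π x : M, TangentSpace I x} {f : M → ℝ} {p : M}

/-- The gradient of a function: `g(grad f, X) = X(f)`. -/
def grad (f : M → ℝ) (x : M) : TangentSpace I x :=
  sharp g (mvfderiv I f x).toLinearMap

@[simp] theorem val_grad (w : TangentSpace I p) :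
    g.val p (grad g f p) w = mvfderiv I f p w :=
  val_sharp g _ w

theorem smoothFieldAt_grad (hf : ContMDiffAt I 𝓘(ℝ, ℝ) ∞ f p) : SmoothFieldAt (grad g f) p := by
  refine g.smoothSectionAt_of_pairing fun X hX ↦ ?_
  simpa only [val_grad] using contMDiffAt_mvfderiv_apply hf hX

/-- The Hessian is metrically dual to the covariant derivative of the gradient. -/
theorem val_cov_grad (hf : ContMDiffAt I 𝓘(ℝ, ℝ) ∞ f p) (hX : MDiffAt (T% X) p)
    (hY : MDiffAt (T% Y) p) :
    g.val p (cov g X (grad g f) p) (Y p) =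
      mvfderiv I (fun x ↦ mvfderiv I f x (Y x)) p (X p) - mvfderiv I f p (cov g X Y p) := by
  have h := cov_metric g hX (smoothFieldAt_grad g hf).mdifferentiableAt hY
  simp only [val_grad] at h
  rw [h, add_sub_cancel_right]

theorem hessian_tangent_apply (hf : ContMDiffAt I 𝓘(ℝ, ℝ) ∞ f p) (hX : SmoothFieldAt X p)
    (hY : SmoothFieldAt Y p) :
    hessian (tangentOps I M) g f p (X p) (Y p) = g.val p (cov g X (grad g f) p) (Y p) := by
  have hG := (smoothFieldAt_grad g hf).mdifferentiableAt
  have hT : TensorialAt I E (fun X ↦ cov g X (grad g f) p) p :=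
    ⟨fun hf hX ↦ cov_smul_left g hf hX hG, fun hX hX' ↦ cov_add_left g hX hX' hG⟩
  let B : LinearMap.BilinForm ℝ (TangentSpace I p) :=
    LinearMap.comp (g.val p) (TensorialAt.mkHom _ p hT).toLinearMap
  have hB : ∀ X Y : Π x : M, TangentSpace I x, SmoothFieldAt X p → SmoothFieldAt Y p →
      B (X p) (Y p) = hessianField (tangentOps I M) g f X Y p := by
    intro X Y hX hY
    refine Eq.trans ?_ (val_cov_grad g hf hX.mdifferentiableAt hY.mdifferentiableAt)
    exact congrArg (fun v ↦ g.val p v (Y p)) (TensorialAt.mkHom_apply hT hX.mdifferentiableAt)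
  rw [hessian_eq hB, hB X Y hX hY]
  exact (val_cov_grad g hf hX.mdifferentiableAt hY.mdifferentiableAt).symm

theorem tensorT_apply (hf : ContMDiffAt I 𝓘(ℝ, ℝ) ∞ f p) (hX : SmoothFieldAt X p)
    (hY : SmoothFieldAt Y p) :
    tensorT g f p (X p) (Y p) =
      g.val p (cov g X (grad g f) p + mvfderiv I f p (X p) • grad g f p) (Y p) := by
  rw [tensorT, LinearMap.add_apply, LinearMap.add_apply, hessian_tangent_apply g hf hX hY, map_add,
    LinearMap.add_apply, map_smul, LinearMap.smul_apply, val_grad]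
  rfl

/-- The endomorphism metrically dual to `T̃`: `g(T̃♯ v, w) = T̃(v, w)`. -/
def sharpT (f : M → ℝ) (p : M) : TangentSpace I p →ₗ[ℝ] TangentSpace I p :=
  haveI : FiniteDimensional ℝ (TangentSpace I p) := inferInstanceAs (FiniteDimensional ℝ E)
  (tensorT g f p).symmCompOfNondegenerate (g.val p) (g.nondegenerate p)

@[simp] theorem val_sharpT (v w : TangentSpace I p) :
    g.val p (sharpT g f p v) w = tensorT g f p v w :=
  haveI : FiniteDimensional ℝ (TangentSpace I p) := inferInstanceAs (FiniteDimensional ℝ E)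
  LinearMap.BilinForm.symmCompOfNondegenerate_left_apply ..

theorem sharpT_apply (hf : ContMDiffAt I 𝓘(ℝ, ℝ) ∞ f p) (hX : SmoothFieldAt X p) :
    sharpT g f p (X p) = cov g X (grad g f) p + mvfderiv I f p (X p) • grad g f p := by
  refine g.ext_of_pairing fun u ↦ ?_
  have h := tensorT_apply g hf hX (smoothSectionAt_extend u)
  rw [val_sharpT]
  rwa [FiberBundle.extend_apply_self] at h

end Hessian

/-! ### Levi-Civita connection of the graded metric -/

section GradedConnection

variable {E : Type*} [NormedAddCommGroup E] [NormedSpace ℝ E]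
  {H : Type*} [TopologicalSpace H] {I : ModelWithCorners ℝ E H}
  {M : Type*} [TopologicalSpace M] [ChartedSpace H M] [IsManifold I ∞ M]
  (g : SemiRiemannianMetric I E (TangentSpace I : M → Type _)) (θ : C^∞⟮I, M; ℝ⟯)

/-- The vector field part `X` of a section `X + f ξ`. -/
def evenPart (S : Π x, GradedTangent I M x) (x : M) : TangentSpace I x := (S x).1

/-- The function part `f` of a section `X + f ξ`. -/
def oddPart (S : Π x, GradedTangent I M x) (x : M) : ℝ := (S x).2

variable {g θ} {S T U : Π x, GradedTangent I M x} {p : M}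

theorem gradedMetric_apply (v w : GradedTangent I M p) :
    (gradedMetric g θ).val p v w =
      g.val p v.1 w.1 + Real.exp (2 * θ p) * ((v.2 : ℝ) * (w.2 : ℝ)) :=
  rfl

variable [FiniteDimensional ℝ E]

variable (g θ) in
theorem mvfderiv_gradedMetric (hS : MDiffAt (T% (evenPart S)) p) (hs : MDiffAt (oddPart S) p)
    (hT : MDiffAt (T% (evenPart T)) p) (ht : MDiffAt (oddPart T) p) (v : TangentSpace I p) :
    mvfderiv I (fun x ↦ (gradedMetric g θ).val x (S x) (T x)) p v =
      mvfderiv I (fun x ↦ g.val x (evenPart S x) (evenPart T x)) p v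
        + Real.exp (2 * θ p) * (2 * mvfderiv I θ p v * oddPart S p * oddPart T p
          + mvfderiv I (oddPart S) p v * oddPart T p
          + oddPart S p * mvfderiv I (oddPart T) p v) := by
  have hst : MDiffAt (fun x ↦ oddPart S x * oddPart T x) p := hs.mul ht
  have hθ : MDiffAt θ p := θ.contMDiff.contMDiffAt.mdifferentiableAt (n := ∞) (by simp)
  have hκ := mdifferentiableAt_exp_two_mul hθ
  have h : mvfderiv I (fun x ↦ g.val x (evenPart S x) (evenPart T x)
      + Real.exp (2 * θ x) * (oddPart S x * oddPart T x)) p v = _ :=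
    congrArg (· v) (mvfderiv_fun_add (g.mdifferentiableAt hS hT) (hκ.mul hst))
  refine h.trans ?_
  have h1 : mvfderiv I ((fun x ↦ Real.exp (2 * θ x)) * fun x ↦ oddPart S x * oddPart T x) p = _ :=
    mvfderiv_mul hκ hst
  rw [add_apply, h1, mvfderiv_fun_mul hs ht]
  simp only [add_apply, smul_apply, smul_eq_mul, mvfderiv_exp_two_mul hθ]
  ring

/-- The Levi-Civita connection of the graded metric:
`∇̂_{X + f ξ}(Y + k ξ) = ∇_X Y - e^{2θ} f k grad θ + (X(k) + X(θ) k + f Y(θ)) ξ`. -/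
theorem leviCivita_graded (hS : MDiffAt (T% (evenPart S)) p) (hs : MDiffAt (oddPart S) p)
    (hT : MDiffAt (T% (evenPart T)) p) (ht : MDiffAt (oddPart T) p) :
    leviCivita (gradedOps I M) (gradedMetric g θ) S T p =
      (cov g (evenPart S) (evenPart T) p
          - (Real.exp (2 * θ p) * (oddPart S p * oddPart T p)) • grad g θ p,
        (mvfderiv I (oddPart T) p (evenPart S p)
          + mvfderiv I θ p (evenPart S p) * oddPart T p
          + oddPart S p * mvfderiv I θ p (evenPart T p) : ℝ)) := by
  refine leviCivita_eq_of_koszul fun U hU ↦ ?_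
  rw [smoothSectionAt_graded_iff] at hU
  have hZ : MDiffAt (T% (evenPart U)) p := hU.1.mdifferentiableAt
  have hz : MDiffAt (oddPart U) p := hU.2.mdifferentiableAt (by simp)
  have h := two_mul_val_cov g hS hT hZ
  rw [koszul_tangent_apply] at h
  have hk : koszul (gradedOps I M) (gradedMetric g θ) S T U p =
      mvfderiv I (fun x ↦ (gradedMetric g θ).val x (T x) (U x)) p (evenPart S p)
        + mvfderiv I (fun x ↦ (gradedMetric g θ).val x (U x) (S x)) p (evenPart T p)
        - mvfderiv I (fun x ↦ (gradedMetric g θ).val x (S x) (T x)) p (evenPart U p)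
        + (g.val p (VectorField.mlieBracket I (evenPart S) (evenPart T) p) (evenPart U p)
          + Real.exp (2 * θ p) * ((mvfderiv I (oddPart T) p (evenPart S p)
            - mvfderiv I (oddPart S) p (evenPart T p)) * oddPart U p))
        - (g.val p (VectorField.mlieBracket I (evenPart T) (evenPart U) p) (evenPart S p)
          + Real.exp (2 * θ p) * ((mvfderiv I (oddPart U) p (evenPart T p)
            - mvfderiv I (oddPart T) p (evenPart U p)) * oddPart S p))
        + (g.val p (VectorField.mlieBracket I (evenPart U) (evenPart S) p) (evenPart T p)
          + Real.exp (2 * θ p) * ((mvfderiv I (oddPart S) p (evenPart U p)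
            - mvfderiv I (oddPart U) p (evenPart S p)) * oddPart T p)) := rfl
  rw [hk, mvfderiv_gradedMetric g θ hT ht hZ hz, mvfderiv_gradedMetric g θ hZ hz hS hs,
    mvfderiv_gradedMetric g θ hS hs hT ht, gradedMetric_apply]
  change 2 * (g.val p (_ - _) (evenPart U p) + _ * (_ * oddPart U p)) = _
  rw [map_sub, LinearMap.sub_apply, map_smul, LinearMap.smul_apply, val_grad, smul_eq_mul]
  linear_combination h

end GradedConnection

/-! ### Curvature tensor of the graded metric -/

section GradedCurvature

variable {E : Type*} [NormedAddCommGroup E] [NormedSpace ℝ E] [FiniteDimensional ℝ E]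
  {H : Type*} [TopologicalSpace H] {I : ModelWithCorners ℝ E H}
  {M : Type*} [TopologicalSpace M] [ChartedSpace H M] [IsManifold I ∞ M]
  (g : SemiRiemannianMetric I E (TangentSpace I : M → Type _)) (θ : C^∞⟮I, M; ℝ⟯)
  {S T U : Π x, GradedTangent I M x} {p : M}

/-- The second covariant derivative `∇̂_S ∇̂_T U` of sections `S = X + f ξ`, `T = Y + k ξ`,
`U = Z + h ξ`. -/
theorem leviCivita_leviCivita_graded {X Y Z : Π x : M, TangentSpace I x} {f k h : M → ℝ}
    (hX : SmoothFieldAt X p) (hf : ContMDiffAt I 𝓘(ℝ, ℝ) ∞ f p)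
    (hY : SmoothFieldAt Y p) (hk : ContMDiffAt I 𝓘(ℝ, ℝ) ∞ k p)
    (hZ : SmoothFieldAt Z p) (hh : ContMDiffAt I 𝓘(ℝ, ℝ) ∞ h p)
    (hSX : evenPart S = X) (hSf : oddPart S = f) (hTY : evenPart T = Y) (hTk : oddPart T = k)
    (hUZ : evenPart U = Z) (hUh : oddPart U = h) :
    leviCivita (gradedOps I M) (gradedMetric g θ) S
        (leviCivita (gradedOps I M) (gradedMetric g θ) T U) p =
      (cov g X (cov g Y Z) p
          - (Real.exp (2 * θ p) * (k p * h p)) • cov g X (grad g θ) p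
          - (Real.exp (2 * θ p) * (2 * mvfderiv I θ p (X p) * k p * h p
              + mvfderiv I k p (X p) * h p + k p * mvfderiv I h p (X p)
              + f p * (mvfderiv I h p (Y p) + mvfderiv I θ p (Y p) * h p
                + k p * mvfderiv I θ p (Z p)))) • grad g θ p,
        (mvfderiv I (fun x ↦ mvfderiv I h x (Y x)) p (X p)
          + mvfderiv I (fun x ↦ mvfderiv I θ x (Y x)) p (X p) * h p
          + mvfderiv I θ p (Y p) * mvfderiv I h p (X p)
          + mvfderiv I k p (X p) * mvfderiv I θ p (Z p)
          + k p * mvfderiv I (fun x ↦ mvfderiv I θ x (Z x)) p (X p)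
          + mvfderiv I θ p (X p) * (mvfderiv I h p (Y p) + mvfderiv I θ p (Y p) * h p
                + k p * mvfderiv I θ p (Z p))
          + f p * (mvfderiv I θ p (cov g Y Z p)
            - Real.exp (2 * θ p) * (k p * h p) * mvfderiv I θ p (grad g θ p)) : ℝ)) := by
  have hθ : ContMDiffAt I 𝓘(ℝ, ℝ) ∞ θ p := θ.contMDiff.contMDiffAt
  have hG := smoothFieldAt_grad g hθ
  have hYZ := hY.cov g hZ
  have dX := hX.mdifferentiableAt
  have df := hf.mdifferentiableAt (n := ∞) (by simp)
  have dk := hk.mdifferentiableAt (n := ∞) (by simp)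
  have dh := hh.mdifferentiableAt (n := ∞) (by simp)
  have dθ := hθ.mdifferentiableAt (n := ∞) (by simp)
  have dκ := mdifferentiableAt_exp_two_mul dθ
  -- Near `p` the inner derivative is `V + w ξ` with `V = ∇_Y Z + m grad θ`.
  set m : M → ℝ := fun x ↦ -(Real.exp (2 * θ x) * (k x * h x)) with hm
  set w : M → ℝ := fun x ↦ mvfderiv I h x (Y x) + mvfderiv I θ x (Y x) * h x
    + k x * mvfderiv I θ x (Z x) with hw
  have hYh := (contMDiffAt_mvfderiv_apply hh hY).mdifferentiableAt (n := ∞) (by simp)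
  have hYθ := (contMDiffAt_mvfderiv_apply hθ hY).mdifferentiableAt (n := ∞) (by simp)
  have hZθ := (contMDiffAt_mvfderiv_apply hθ hZ).mdifferentiableAt (n := ∞) (by simp)
  have dm : MDiffAt m p := (dκ.mul (dk.mul dh)).neg
  have dw : MDiffAt w p := (hYh.add (hYθ.mul dh)).add (dk.mul hZθ)
  have dmG : MDiffAt (T% (m • grad g θ)) p := dm.smul_section hG.mdifferentiableAt
  have dV : MDiffAt (T% (cov g Y Z + m • grad g θ)) p :=
    mdifferentiableAt_add_section hYZ.mdifferentiableAt dmG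
  have hloc : ∀ᶠ x in nhds p, leviCivita (gradedOps I M) (gradedMetric g θ) T U x =
      ((cov g Y Z + m • grad g θ) x, (w x : ℝ)) := by
    filter_upwards [hY.eventually_mdifferentiableAt, hZ.eventually_mdifferentiableAt,
      eventually_mdifferentiableAt hk, eventually_mdifferentiableAt hh] with x h1 h2 h3 h4
    subst hTY hTk hUZ hUh
    rw [leviCivita_graded h1 h3 h2 h4, sub_eq_add_neg, ← neg_smul]
    rfl
  have he : ∀ᶠ x in nhds p, evenPart (leviCivita (gradedOps I M) (gradedMetric g θ) T U) x =
      (cov g Y Z + m • grad g θ) x := hloc.mono fun x hx ↦ congrArg Prod.fst hx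
  have ho : oddPart (leviCivita (gradedOps I M) (gradedMetric g θ) T U) =ᶠ[nhds p] w :=
    hloc.mono fun x hx ↦ congrArg Prod.snd hx
  have de : MDiffAt (T% (evenPart (leviCivita (gradedOps I M) (gradedMetric g θ) T U))) p :=
    dV.congr_of_eventuallyEq (he.mono fun x hx ↦ by simp only [hx])
  have do' : MDiffAt (oddPart (leviCivita (gradedOps I M) (gradedMetric g θ) T U)) p :=
    dw.congr_of_eventuallyEq ho
  have hdm : mvfderiv I m p (X p) = -(Real.exp (2 * θ p) * (2 * mvfderiv I θ p (X p) * k p * h p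
      + mvfderiv I k p (X p) * h p + k p * mvfderiv I h p (X p))) := by
    have dkh : MDiffAt (fun x ↦ k x * h x) p := dk.mul dh
    rw [hm, mvfderiv_fun_neg, mvfderiv_fun_mul dκ dkh, mvfderiv_fun_mul dk dh]
    simp only [neg_apply, add_apply, smul_apply, smul_eq_mul, mvfderiv_exp_two_mul dθ]
    ring
  have hdw : mvfderiv I w p (X p) = mvfderiv I (fun x ↦ mvfderiv I h x (Y x)) p (X p)
          + mvfderiv I (fun x ↦ mvfderiv I θ x (Y x)) p (X p) * h p
          + mvfderiv I θ p (Y p) * mvfderiv I h p (X p)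
          + mvfderiv I k p (X p) * mvfderiv I θ p (Z p)
          + k p * mvfderiv I (fun x ↦ mvfderiv I θ x (Z x)) p (X p) := by
    have d1 : MDiffAt (fun x ↦ mvfderiv I θ x (Y x) * h x) p := hYθ.mul dh
    have d2 : MDiffAt (fun x ↦ mvfderiv I h x (Y x) + mvfderiv I θ x (Y x) * h x) p := hYh.add d1
    have d3 : MDiffAt (fun x ↦ k x * mvfderiv I θ x (Z x)) p := dk.mul hZθ
    rw [hw, mvfderiv_fun_add d2 d3, mvfderiv_fun_add hYh d1, mvfderiv_fun_mul hYθ dh,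
      mvfderiv_fun_mul dk hZθ]
    simp only [add_apply, smul_apply, smul_eq_mul]
    ring
  subst hSX hSf
  rw [leviCivita_graded dX df de do', cov_congr_right g dX dV he,
    cov_add_right g dX hYZ.mdifferentiableAt dmG,
    cov_smul_right g dm dX hG.mdifferentiableAt, mvfderiv_congr ho, he.self_of_nhds,
    ho.self_of_nhds, hdm, hdw]
  refine Prod.ext ?_ ?_
  · simp only [hm, hw]
    module
  · simp only [hm, hw, Pi.add_apply, Pi.smul_apply', map_add, map_smul, smul_eq_mul]
    ring

/-- The curvature tensor of the graded metric: for `u = v + a ξ`, `w = y + b ξ`, `t = z + c ξ`,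
`R̂(u, w) t = R(v, y) z - e^{2θ} c (b T̃♯ v - a T̃♯ y) + (b T̃(v, z) - a T̃(y, z)) ξ`. -/
def gradedCurvature (p : M) : GradedTangent I M p →ₗ[ℝ] GradedTangent I M p →ₗ[ℝ]
    GradedTangent I M p →ₗ[ℝ] GradedTangent I M p :=
  LinearMap.mk₂ ℝ
    (fun u w : TangentSpace I p × ℝ ↦
      ((curvatureTensor (tangentOps I M) g p u.1 w.1 ∘ₗ LinearMap.fst ℝ (TangentSpace I p) ℝ
        - (LinearMap.snd ℝ (TangentSpace I p) ℝ).smulRight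
          (Real.exp (2 * θ p) • (w.2 • sharpT g θ p u.1 - u.2 • sharpT g θ p w.1))).prod
      ((w.2 • tensorT g θ p u.1 - u.2 • tensorT g θ p w.1) ∘ₗ
        LinearMap.fst ℝ (TangentSpace I p) ℝ) :
        (TangentSpace I p × ℝ) →ₗ[ℝ] (TangentSpace I p × ℝ)))
    (fun u u' w ↦ by
      refine LinearMap.ext fun t ↦ Prod.ext ?_ ?_
      · simp; module
      · simp; ring)
    (fun c u w ↦ by
      refine LinearMap.ext fun t ↦ Prod.ext ?_ ?_
      · simp; module
      · simp; ring)
    (fun u w w' ↦ by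
      refine LinearMap.ext fun t ↦ Prod.ext ?_ ?_
      · simp; module
      · simp; ring)
    (fun c u w ↦ by
      refine LinearMap.ext fun t ↦ Prod.ext ?_ ?_
      · simp; module
      · simp; ring)

theorem gradedCurvature_apply (u w t : GradedTangent I M p) :
    gradedCurvature g θ p u w t =
      (curvatureTensor (tangentOps I M) g p u.1 w.1 t.1
        - (t.2 : ℝ) • Real.exp (2 * θ p) •
          ((w.2 : ℝ) • sharpT g θ p u.1 - (u.2 : ℝ) • sharpT g θ p w.1),
        ((w.2 : ℝ) * tensorT g θ p u.1 t.1 - (u.2 : ℝ) * tensorT g θ p w.1 t.1 : ℝ)) :=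
  rfl

/-- The derivatives of the odd coefficients cancel in `∇̂_S ∇̂_T U - ∇̂_T ∇̂_S U - ∇̂_[S,T] U`. -/
theorem curvatureTensor_graded :
    curvatureTensor (gradedOps I M) (gradedMetric g θ) p = gradedCurvature g θ p := by
  refine curvatureTensor_eq fun S T U hS hT hU ↦ ?_
  rw [smoothSectionAt_graded_iff] at hS hT hU
  -- Opaque names for the parts keep the final identities free of projections of `S`, `T`, `U`.
  obtain ⟨X, hXd⟩ : ∃ X, X = evenPart S := ⟨_, rfl⟩
  obtain ⟨Y, hYd⟩ : ∃ Y, Y = evenPart T := ⟨_, rfl⟩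
  obtain ⟨Z, hZd⟩ : ∃ Z, Z = evenPart U := ⟨_, rfl⟩
  obtain ⟨f, hfd⟩ : ∃ f, f = oddPart S := ⟨_, rfl⟩
  obtain ⟨k, hkd⟩ : ∃ k, k = oddPart T := ⟨_, rfl⟩
  obtain ⟨h, hhd⟩ : ∃ h, h = oddPart U := ⟨_, rfl⟩
  have hX : SmoothFieldAt X p := hXd ▸ hS.1
  have hY : SmoothFieldAt Y p := hYd ▸ hT.1
  have hZ : SmoothFieldAt Z p := hZd ▸ hU.1
  have hf : ContMDiffAt I 𝓘(ℝ, ℝ) ∞ f p := hfd ▸ hS.2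
  have hk : ContMDiffAt I 𝓘(ℝ, ℝ) ∞ k p := hkd ▸ hT.2
  have hh : ContMDiffAt I 𝓘(ℝ, ℝ) ∞ h p := hhd ▸ hU.2
  have hθ : ContMDiffAt I 𝓘(ℝ, ℝ) ∞ θ p := θ.contMDiff.contMDiffAt
  -- `[S, T] = [X, Y] + (X(k) - Y(f)) ξ`
  have hXY := hX.mlieBracket hY
  have he : evenPart ((gradedOps I M).bracket S T) = VectorField.mlieBracket I X Y := by
    rw [hXd, hYd]; rfl
  have ho : oddPart ((gradedOps I M).bracket S T) =
      fun x ↦ mvfderiv I k x (X x) - mvfderiv I f x (Y x) := by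
    rw [hXd, hYd, hkd, hfd]; rfl
  have hXk := (contMDiffAt_mvfderiv_apply hk hX).mdifferentiableAt (n := ∞) (by simp)
  have hYf := (contMDiffAt_mvfderiv_apply hf hY).mdifferentiableAt (n := ∞) (by simp)
  have h3 := leviCivita_graded (g := g) (θ := θ) (S := (gradedOps I M).bracket S T) (T := U)
    (p := p) (by rw [he]; exact hXY.mdifferentiableAt) (by rw [ho]; exact hXk.sub hYf)
    hU.1.mdifferentiableAt (hU.2.mdifferentiableAt (by simp))
  rw [he, ho, ← hZd, ← hhd, mvfderiv_mlieBracket hX hY hh, mvfderiv_mlieBracket hX hY hθ] at h3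
  -- The tensor on the left, with `T̃` and `T̃♯` expressed through `∇` and the derivatives of `θ`.
  have hval : gradedCurvature g θ p (S p) (T p) (U p) =
      (curvature (tangentOps I M) g X Y Z p
        - h p • Real.exp (2 * θ p) •
          (k p • (cov g X (grad g θ) p + mvfderiv I θ p (X p) • grad g θ p)
            - f p • (cov g Y (grad g θ) p + mvfderiv I θ p (Y p) • grad g θ p)),
        (k p * (mvfderiv I (fun x ↦ mvfderiv I θ x (Z x)) p (X p)
            - mvfderiv I θ p (cov g X Z p) + mvfderiv I θ p (X p) * mvfderiv I θ p (Z p))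
          - f p * (mvfderiv I (fun x ↦ mvfderiv I θ x (Z x)) p (Y p)
            - mvfderiv I θ p (cov g Y Z p) + mvfderiv I θ p (Y p) * mvfderiv I θ p (Z p)) : ℝ)) := by
    rw [← curvatureTensor_tangent_apply g hX hY hZ, ← sharpT_apply g hθ hX, ← sharpT_apply g hθ hY,
      ← val_cov_grad g hθ hX.mdifferentiableAt hZ.mdifferentiableAt,
      ← val_cov_grad g hθ hY.mdifferentiableAt hZ.mdifferentiableAt]
    have hT : ∀ {X : Π x : M, TangentSpace I x}, SmoothFieldAt X p →
        g.val p (cov g X (grad g θ) p) (Z p) + mvfderiv I θ p (X p) * mvfderiv I θ p (Z p) =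
          tensorT g θ p (X p) (Z p) := by
      intro X hX
      rw [tensorT_apply g hθ hX hZ, map_add, LinearMap.add_apply, map_smul, LinearMap.smul_apply,
        val_grad, smul_eq_mul]
    rw [hT hX, hT hY, hXd, hYd, hZd, hfd, hkd, hhd]
    rfl
  rw [hval, curvature_tangent_apply, curvature, leviCivita_leviCivita_graded g θ hX hf hY
    hk hZ hh hXd.symm hfd.symm hYd.symm hkd.symm hZd.symm hhd.symm, leviCivita_leviCivita_graded g θ hY hk hX hf hZ hh
    hYd.symm hkd.symm hXd.symm hfd.symm hZd.symm hhd.symm, h3]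
  refine Prod.ext ?_ ?_
  · simp only [Prod.fst_sub]
    module
  · simp only [Prod.snd_sub]
    ring

end GradedCurvature

/-! ### Metric traces and the Ricci tensor -/

section Trace

/-- The trace of an endomorphism of `V × ℝ` is the sum of the traces of its diagonal blocks. -/
theorem trace_prod_real {V : Type*} [AddCommGroup V] [Module ℝ V] [FiniteDimensional ℝ V]
    (L : V × ℝ →ₗ[ℝ] V × ℝ) :
    LinearMap.trace ℝ (V × ℝ) L =
      LinearMap.trace ℝ V (LinearMap.fst ℝ V ℝ ∘ₗ L ∘ₗ LinearMap.inl ℝ V ℝ) + (L (0, 1)).2 := by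
  have hL : L = LinearMap.inl ℝ V ℝ ∘ₗ (LinearMap.fst ℝ V ℝ ∘ₗ L)
      + LinearMap.inr ℝ V ℝ ∘ₗ (LinearMap.snd ℝ V ℝ ∘ₗ L) :=
    LinearMap.ext fun v ↦ by simp
  have h1 (K : ℝ →ₗ[ℝ] ℝ) : LinearMap.trace ℝ ℝ K = K 1 := by
    have hK : K = K 1 • LinearMap.id := LinearMap.ext_ring (by simp)
    rw [hK]
    simp
  conv_lhs => rw [hL]
  rw [map_add, LinearMap.trace_comp_comm', LinearMap.trace_comp_comm' (LinearMap.snd ℝ V ℝ ∘ₗ L),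
    h1]
  rfl

variable {E : Type*} [NormedAddCommGroup E] [NormedSpace ℝ E] [FiniteDimensional ℝ E]
  {H : Type*} [TopologicalSpace H] {I : ModelWithCorners ℝ E H}
  {M : Type*} [TopologicalSpace M] [ChartedSpace H M] [IsManifold I ∞ M]
  (g : SemiRiemannianMetric I E (TangentSpace I : M → Type _)) (θ : C^∞⟮I, M; ℝ⟯) {p : M}

/-- A bilinear form whose restriction to even vectors is `B`, and whose value at `(ξ, ξ)` is
`e^{2θ} c`, has graded trace `tr B + c`. -/
theorem trace_gradedMetric {B' : LinearMap.BilinForm ℝ (GradedTangent I M p)}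
    {B : LinearMap.BilinForm ℝ (TangentSpace I p)} {c : ℝ}
    (hB : ∀ v w : TangentSpace I p, B' (even v) (even w) = B v w)
    (hc : B' (xi I p) (xi I p) = Real.exp (2 * θ p) * c) :
    (gradedMetric g θ).trace p B' = g.trace p B + c := by
  have : FiniteDimensional ℝ (TangentSpace I p) := inferInstanceAs (FiniteDimensional ℝ E)
  have : FiniteDimensional ℝ (GradedTangent I M p) :=
    inferInstanceAs (FiniteDimensional ℝ (TangentSpace I p × ℝ))
  set L : TangentSpace I p × ℝ →ₗ[ℝ] TangentSpace I p × ℝ :=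
    B'.symmCompOfNondegenerate ((gradedMetric g θ).val p) ((gradedMetric g θ).nondegenerate p)
    with hL
  have hLval (v w : GradedTangent I M p) : (gradedMetric g θ).val p (L v) w = B' v w :=
    LinearMap.BilinForm.symmCompOfNondegenerate_left_apply ..
  have h1 : LinearMap.fst ℝ (TangentSpace I p) ℝ ∘ₗ L ∘ₗ LinearMap.inl ℝ (TangentSpace I p) ℝ =
      B.symmCompOfNondegenerate (g.val p) (g.nondegenerate p) := by
    refine LinearMap.ext fun v ↦ g.ext_of_pairing fun w ↦ ?_
    have h := hLval (even v) (even w)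
    rw [hB, gradedMetric_apply] at h
    rw [LinearMap.BilinForm.symmCompOfNondegenerate_left_apply, ← h]
    simp [even]
  have h2 : (L (0, 1)).2 = c := by
    have h := hLval (xi I p) (xi I p)
    rw [hc, gradedMetric_apply] at h
    have h' : Real.exp (2 * θ p) * (L (0, 1)).2 = Real.exp (2 * θ p) * c := by
      simpa [xi] using h
    exact mul_left_cancel₀ (Real.exp_ne_zero _) h'
  have h3 := trace_prod_real L
  rw [h1, h2] at h3
  exact h3

theorem trace_smul (c : ℝ) (B : LinearMap.BilinForm ℝ (TangentSpace I p)) :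
    g.trace p (c • B) = c * g.trace p B := by
  have : FiniteDimensional ℝ (TangentSpace I p) := inferInstanceAs (FiniteDimensional ℝ E)
  have h : (c • B).symmCompOfNondegenerate (g.val p) (g.nondegenerate p) =
      c • B.symmCompOfNondegenerate (g.val p) (g.nondegenerate p) := by
    refine LinearMap.ext fun v ↦ g.ext_of_pairing fun w ↦ ?_
    rw [LinearMap.BilinForm.symmCompOfNondegenerate_left_apply, LinearMap.smul_apply,
      LinearMap.smul_apply, LinearMap.smul_apply, map_smul, LinearMap.smul_apply,
      LinearMap.BilinForm.symmCompOfNondegenerate_left_apply]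
  have h1 : LinearMap.trace ℝ (TangentSpace I p)
      ((c • B).symmCompOfNondegenerate (g.val p) (g.nondegenerate p)) =
      c * LinearMap.trace ℝ (TangentSpace I p)
        (B.symmCompOfNondegenerate (g.val p) (g.nondegenerate p)) := by
    rw [h, map_smul, smul_eq_mul]
  exact h1

end Trace

section Ricci

variable {E : Type*} [NormedAddCommGroup E] [NormedSpace ℝ E] [FiniteDimensional ℝ E]
  {H : Type*} [TopologicalSpace H] {I : ModelWithCorners ℝ E H}
  {M : Type*} [TopologicalSpace M] [ChartedSpace H M] [IsManifold I ∞ M]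
  (g : SemiRiemannianMetric I E (TangentSpace I : M → Type _)) (θ : C^∞⟮I, M; ℝ⟯) {p : M}

theorem ricci_graded_even_even (v w : TangentSpace I p) :
    ricci (gradedOps I M) (gradedMetric g θ) p (even v) (even w) =
      ricci (tangentOps I M) g p v w - tensorT g θ p v w := by
  rw [ricci, curvatureTensor_graded, ricci, sub_eq_add_neg]
  refine trace_gradedMetric g θ (fun a b ↦ ?_) ?_
  · change (gradedMetric g θ).val p (gradedCurvature g θ p (even v) (even a) (even b)) (even w) =
      g.val p (curvatureTensor (tangentOps I M) g p v a b) w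
    rw [gradedMetric_apply, gradedCurvature_apply]
    simp [even]
  · change (gradedMetric g θ).val p (gradedCurvature g θ p (even v) (xi I p) (xi I p)) (even w) = _
    rw [gradedMetric_apply, gradedCurvature_apply]
    simp [even, xi]

theorem ricci_graded_even_xi (v : TangentSpace I p) :
    ricci (gradedOps I M) (gradedMetric g θ) p (even v) (xi I p) = 0 := by
  have h0 : g.trace p (0 : LinearMap.BilinForm ℝ (TangentSpace I p)) + 0 = 0 := by
    simpa using trace_smul g (p := p) 0 0
  rw [ricci, curvatureTensor_graded, ← h0]
  refine trace_gradedMetric g θ (fun a b ↦ ?_) ?_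
  · change (gradedMetric g θ).val p (gradedCurvature g θ p (even v) (even a) (even b)) (xi I p) = 0
    rw [gradedMetric_apply, gradedCurvature_apply]
    simp [even, xi]
  · change (gradedMetric g θ).val p (gradedCurvature g θ p (even v) (xi I p) (xi I p)) (xi I p) = _
    rw [gradedMetric_apply, gradedCurvature_apply]
    simp [even, xi]

theorem ricci_graded_xi_xi :
    ricci (gradedOps I M) (gradedMetric g θ) p (xi I p) (xi I p) =
      -Real.exp (2 * θ p) * g.trace p (tensorT g θ p) := by
  rw [ricci, curvatureTensor_graded, ← trace_smul, ← add_zero (g.trace p _)]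
  refine trace_gradedMetric g θ (fun a b ↦ ?_) ?_
  · change (gradedMetric g θ).val p (gradedCurvature g θ p (xi I p) (even a) (even b)) (xi I p) =
      -Real.exp (2 * θ p) * tensorT g θ p a b
    rw [gradedMetric_apply, gradedCurvature_apply]
    simp [even, xi]
  · change (gradedMetric g θ).val p (gradedCurvature g θ p (xi I p) (xi I p) (xi I p)) (xi I p) = _
    rw [gradedMetric_apply, gradedCurvature_apply]
    simp [xi]

end Ricci

end GradedGeometry

end

open GradedGeometry in
theorem mainTheorem3 (n : ℕ) (M : Type*) [TopologicalSpace M]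
    [ChartedSpace (EuclideanSpace ℝ (Fin n)) M] [IsManifold (𝓡 n) ∞ M]
    (g : SemiRiemannianMetric (𝓡 n) (EuclideanSpace ℝ (Fin n))
      (TangentSpace (𝓡 n) : M → Type _))
    (θ : C^∞⟮𝓡 n, M; ℝ⟯) (p : M) :
    (∀ v w : TangentSpace (𝓡 n) p,
      ricci (gradedOps (𝓡 n) M) (gradedMetric g θ) p (even v) (even w)
        = ricci (tangentOps (𝓡 n) M) g p v w - tensorT g θ p v w) ∧
    (∀ v : TangentSpace (𝓡 n) p,
      ricci (gradedOps (𝓡 n) M) (gradedMetric g θ) p (even v) (xi (𝓡 n) p) = 0) ∧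
    ricci (gradedOps (𝓡 n) M) (gradedMetric g θ) p (xi (𝓡 n) p) (xi (𝓡 n) p)
      = - Real.exp (2 * θ p) * g.trace p (tensorT g θ p) :=
  ⟨ricci_graded_even_even g θ, ricci_graded_even_xi g θ, ricci_graded_xi_xi g θ⟩
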